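/- Let $q$ be a prime power and $g\ge 1$. Let $K$ be a number field of degree $2g$ and let $\alpha\in K$ be a Weil $q$-number, i.e. an algebraic integer with $|\varphi(\alpha)|=\sqrt q$ for every embedding $\varphi:K\to\mathbb{C}$. Assume that $\mathbb{Q}(\alpha^n)=K$ for every integer $n\ge 1$. (This holds, with $K=\mathbb{Q}(\alpha)$, when $\alpha$ is the Weil number of an ordinary, geometrically simple abelian variety of dimension $g$ over $\mathbb{F}_q$.) For $n\ge 1$ let $$R_n=\mathbb{Z}[\alpha^n,(q/\alpha)^n],\qquad R_n^+=\mathbb{Z}[\alpha^n+(q/\alpha)^n].$$ Let $\mathcal{C}\ell(R_n)$ be the class group of $R_n$ (invertible fractional ideals modulo principal ones), and let $\mathcal{C}\ell^+(R_n^+)$ be the narrow class group of $R_n^+$ (invertible fractional ideals modulo those generated by an element of the fraction field that is positive under every real embedding). Then there are a set $S$ of positive integers of natural density one and a function $\varepsilon:\mathbb{N}\to\mathbb{R}$ with $\varepsilon(n)\to 0$ as $n\to\infty$ such that, for every $n\in S$, $$\frac{\#\mathcal{C}\ell(R_n)}{\#\mathcal{C}\ell^+(R_n^+)}=(q^n)^{\frac{g(g+1)}{4}+\varepsilon(n)}.$$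 -/

import Mathlib

open Filter Topology
open scoped nonZeroDivisors IntermediateField

/-- `S` has natural density `d`: `#(S ∩ {1, …, N}) / N → d`. -/
def HasNaturalDensity (S : Set ℕ) (d : ℝ) : Prop :=
  Tendsto (fun N : ℕ => ((S ∩ Set.Icc 1 N).ncard : ℝ) / (N : ℝ)) atTop (𝓝 d)

/-- `α` is a Weil `q`-number: an algebraic integer all of whose complex conjugates have
absolute value `√q`. -/
def IsWeilNumber {K : Type*} [Field K] (q : ℕ) (α : K) : Prop :=
  IsIntegral ℤ α ∧ ∀ φ : K →+* ℂ, ‖φ α‖ = Real.sqrt (q : ℝ)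

/-- The ring `R_n = ℤ[α ^ n, (q / α) ^ n]`. -/
def weilOrder {K : Type*} [Field K] (q : ℕ) (α : K) (n : ℕ) : Subalgebra ℤ K :=
  Algebra.adjoin ℤ {α ^ n, ((q : K) / α) ^ n}

/-- The ring `R_n⁺ = ℤ[α ^ n + (q / α) ^ n]`. -/
def realWeilOrder {K : Type*} [Field K] (q : ℕ) (α : K) (n : ℕ) : Subalgebra ℤ K :=
  Algebra.adjoin ℤ {α ^ n + ((q : K) / α) ^ n}

/-- The group of totally positive elements of a field `F`: the nonzero elements that are
positive under every real embedding of `F`. -/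
def totallyPositiveUnits (F : Type*) [Field F] : Subgroup Fˣ where
  carrier := {x | ∀ φ : F →+* ℝ, 0 < φ (x : F)}
  one_mem' := fun φ => by simp
  mul_mem' := fun {x y} hx hy φ => by
    simpa using mul_pos (hx φ) (hy φ)
  inv_mem' := fun {x} hx φ => by
    simpa using hx φ

/-- The narrow class group of a domain `R`: invertible fractional ideals of `R` modulo the
principal ones generated by a totally positive element of the fraction field. (The ordinary class
group `ClassGroup R` is the quotient of the same group by all principal fractional ideals.) -/
abbrev NarrowClassGroup (R : Type*) [CommRing R] [IsDomain R] : Type _ :=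
  (FractionalIdeal R⁰ (FractionRing R))ˣ ⧸
    (totallyPositiveUnits (FractionRing R)).map (toPrincipalIdeal R (FractionRing R))

/-!
Write `K⁺` for the maximal real subfield of `K` and `T = √q`. The hypotheses make `K` a CM field on
which complex conjugation sends `α` to `q / α` (`IsWeilNumber.isCMField`). The real order
`ℤ[β]`, `β = α ^ n + (q / α) ^ n`, is viewed inside `K⁺`, and
`weilOrder q α n = ℤ[β] ⊕ α ^ n ℤ[β]`.

*Class numbers of orders.* Let `R` be an order of index `m` in the maximal order `𝓞`. Extension of
ideals from `R` to `𝓞` gives `# Cl(R) * [𝓞ˣ : Rˣ] = # {I : I 𝓞 = 𝓞} * c` with `c ∣ # Cl(𝓞)`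
(`card_classGroup_mul_relIndex`). For an ideal `f ⊆ R` of `𝓞`, the invertible `I` with `I 𝓞 = 𝓞` are
the modules `R u + f`, `u ∈ (𝓞 / f)ˣ`, so that there are `# (𝓞 / f)ˣ / # (R / (f ∩ R))ˣ` of them
(`card_locallyTrivial_mul_card_units`). In a finite ring killed by `m` the proportion of units is at
least a fixed power of `1 / (ω(m) + 1)` (`card_le_card_units_mul`). Hence
`# Cl(R) * [𝓞ˣ : Rˣ]` equals `m` up to a factor polynomial in `ω(m) ≤ log₂ m`. The unit indices of the
two orders differ by a bounded factor since `𝓞_{K⁺}ˣ` has finite index in `𝓞_Kˣ`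
(`relIndex_unitsIn_bounds`), and so do narrow and ordinary class numbers.

*Indices.* With `α ^ n = a + b α`, `a, b ∈ 𝓞_{K⁺}`, the index of `weilOrder q α n` is
`c₁ |N b| [𝓞_{K⁺} : ℤ[β]] ^ 2` for a constant `c₁`. The remaining quotient
`c₁ |N b| [𝓞_{K⁺} : ℤ[β]]` is, up to constants, the product of the `g` numbers `|αᵢ ^ n - conj αᵢ ^ n|`
and of the `g (g - 1) / 2` differences of conjugates of `β`, by the discriminant of `ℤ[β]`
(`orderIndex_adjoin_sq`). Each factor equals `T ^ n` up to a polynomial in `n` as soon as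
`|u ^ n - 1| ≥ 1 / n` for all quotients `u` of two distinct conjugates of `α`, which gives
`T ^ (n g (g + 1) / 2)`.

*Density.* Such `u` lie on the unit circle and are not roots of unity. If `u ^ n` and `u ^ m` are both
close to `1`, so is `u ^ (n - m)`, hence the exceptional `n` have arbitrarily large gaps
and density zero (`tendsto_card_pow_near_one`). The polynomial factors are absorbed in `ε`
(`PolyComparable.exists_exponent`).
-/

/-! ### Class groups under extension of an order -/

section ExactSequence

/-- The group of units of `A`, seen inside the multiplicative group of the field `F`. -/
def unitsIn (A F : Type*) [CommRing A] [Field F] [Algebra A F] : Subgroup Fˣ :=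
  (Units.map (algebraMap A F : A →* F)).range

/-- The homomorphism sending `x` to the principal invertible submodule `A x`. -/
noncomputable def principalHom (A F : Type*) [CommRing A] [Field F] [Algebra A F] :
    Fˣ →* (Submodule A F)ˣ :=
  Units.map (Submodule.spanSingleton A).toMonoidHom

theorem val_principalHom (A : Type*) {F : Type*} [CommRing A] [Field F] [Algebra A F] (x : Fˣ) :
    (principalHom A F x : Submodule A F) = Submodule.span A {(x : F)} := rfl

theorem mem_unitsIn_iff (A : Type*) {F : Type*} [CommRing A] [Field F] [Algebra A F]
    [FaithfulSMul A F] (x : Fˣ) :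
    x ∈ unitsIn A F ↔ (x : F) ∈ (1 : Submodule A F) ∧ ((x⁻¹ : Fˣ) : F) ∈ (1 : Submodule A F) := by
  simp only [Submodule.mem_one]
  constructor
  · rintro ⟨u, rfl⟩
    exact ⟨⟨u, rfl⟩, ⟨(u⁻¹ : Aˣ), by rw [← map_inv]; rfl⟩⟩
  · rintro ⟨⟨y, hy⟩, ⟨z, hz⟩⟩
    have hinj := FaithfulSMul.algebraMap_injective A F
    have h : y * z = 1 := hinj (by rw [map_mul, hy, hz, map_one, Units.mul_inv])
    exact ⟨⟨y, z, h, by rw [mul_comm, h]⟩, Units.ext hy⟩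

theorem ker_principalHom (A F : Type*) [CommRing A] [Field F] [Algebra A F]
    [FaithfulSMul A F] : (principalHom A F).ker = unitsIn A F := by
  ext x
  rw [MonoidHom.mem_ker, mem_unitsIn_iff]
  constructor
  · intro h
    have key : ∀ y : Fˣ, principalHom A F y = 1 → (y : F) ∈ (1 : Submodule A F) := by
      intro y hy
      have := congrArg Units.val hy
      rw [val_principalHom, Units.val_one] at this
      rw [← this]
      exact Submodule.mem_span_singleton_self _
    exact ⟨key _ h, key _ (by rw [map_inv, h, inv_one])⟩
  · rintro ⟨h1, h2⟩
    apply Units.ext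
    rw [val_principalHom, Units.val_one]
    apply le_antisymm
    · rwa [Submodule.span_singleton_le_iff_mem]
    · rw [Submodule.one_le, Submodule.mem_span_singleton]
      obtain ⟨a, ha⟩ := Submodule.mem_one.1 h2
      exact ⟨a, by rw [Algebra.smul_def, ha, Units.inv_mul]⟩

theorem card_classGroup_eq_index (A F : Type*) [CommRing A] [IsDomain A] [Field F] [Algebra A F]
    [IsFractionRing A F] : Nat.card (ClassGroup A) = (principalHom A F).range.index := by
  have h : (toPrincipalIdeal A F).range.map
      (FractionalIdeal.unitsMulEquivSubmodule (S := A⁰) (P := F) : _ →* (Submodule A F)ˣ) =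
      (principalHom A F).range := by
    rw [MonoidHom.map_range]
    congr 1
    ext x : 2
    rw [val_principalHom]
    simp [FractionalIdeal.unitsMulEquivSubmodule]
  rw [Nat.card_congr (ClassGroup.equiv F).toEquiv, ← h, Subgroup.index_map_equiv]
  rfl

variable (R O F : Type*) [CommRing R] [CommRing O] [Field F] [Algebra R O] [Algebra R F]
  [Algebra O F] [IsScalarTower R O F]

/-- Extension of scalars `I ↦ I O` for `R`-submodules of `F`. -/
noncomputable def extendScalarsHom : Submodule R F →* Submodule O F where
  toFun I := Submodule.span O (I : Set F)
  map_one' := by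
    apply le_antisymm
    · rw [Submodule.span_le]
      intro x hx
      obtain ⟨r, rfl⟩ := Submodule.mem_one.1 hx
      exact Submodule.mem_one.2 ⟨algebraMap R O r, (IsScalarTower.algebraMap_apply R O F r).symm⟩
    · rw [Submodule.one_le]
      exact Submodule.subset_span (Submodule.one_le.1 le_rfl)
  map_mul' I J := by
    apply le_antisymm
    · rw [Submodule.span_le]
      intro x hx
      refine Submodule.mul_induction_on hx ?_ ?_
      · intro a ha b hb
        exact Submodule.mul_mem_mul (Submodule.subset_span ha) (Submodule.subset_span hb)
      · intro a b ha hb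
        exact add_mem ha hb
    · rw [Submodule.span_mul_span, Submodule.span_le]
      rintro _ ⟨a, ha, b, hb, rfl⟩
      exact Submodule.subset_span (Submodule.mul_mem_mul ha hb)

theorem extendScalarsHom_apply (I : Submodule R F) :
    extendScalarsHom R O F I = Submodule.span O (I : Set F) := rfl

theorem extendScalarsHom_principalHom (x : Fˣ) :
    Units.map (extendScalarsHom R O F) (principalHom R F x) = principalHom O F x := by
  apply Units.ext
  rw [Units.coe_map, extendScalarsHom_apply, val_principalHom,
    val_principalHom, Submodule.span_span_of_tower]

/-- The invertible `R`-submodules `I` of `F` with `I O = O`. -/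
noncomputable abbrev locallyTrivial : Subgroup (Submodule R F)ˣ :=
  (Units.map (extendScalarsHom R O F)).ker

theorem card_classGroup_mul_relIndex [IsDomain R] [IsDomain O] [IsFractionRing R F]
    [IsFractionRing O F] :
    ∃ c : ℕ, c ∣ Nat.card (ClassGroup O) ∧
      Nat.card (ClassGroup R) * (unitsIn R F).relIndex (unitsIn O F) =
        Nat.card (locallyTrivial R O F) * c := by
  have hR : FaithfulSMul R F := (faithfulSMul_iff_algebraMap_injective R F).2
    (IsFractionRing.injective R F)
  have hO : FaithfulSMul O F := (faithfulSMul_iff_algebraMap_injective O F).2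
    (IsFractionRing.injective O F)
  set E := Units.map (extendScalarsHom R O F)
  set P := (principalHom R F).range with hP
  set Q := (principalHom O F).range with hQ
  have hsup : E.ker ⊔ P = Q.comap E := by
    apply le_antisymm
    · refine sup_le ?_ ?_
      · intro I hI
        rw [Subgroup.mem_comap, MonoidHom.mem_ker.1 hI]
        exact one_mem _
      · rintro _ ⟨x, rfl⟩
        exact ⟨x, (extendScalarsHom_principalHom R O F x).symm⟩
    · rintro I ⟨x, hx⟩
      have hI : I * (principalHom R F x)⁻¹ ∈ E.ker := by
        rw [MonoidHom.mem_ker, map_mul, map_inv, extendScalarsHom_principalHom, hx, mul_inv_cancel]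
      rw [← inv_mul_cancel_right I (principalHom R F x)]
      exact Subgroup.mul_mem_sup hI ⟨x, rfl⟩
  have hinf : E.ker ⊓ P = (unitsIn O F).map (principalHom R F) := by
    ext I
    constructor
    · rintro ⟨hI, x, rfl⟩
      refine ⟨x, ?_, rfl⟩
      rw [SetLike.mem_coe, ← ker_principalHom, MonoidHom.mem_ker,
        ← extendScalarsHom_principalHom R]
      exact hI
    · rintro ⟨x, hx, rfl⟩
      rw [SetLike.mem_coe, ← ker_principalHom] at hx
      exact ⟨(extendScalarsHom_principalHom R O F x).trans hx, x, rfl⟩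
  refine ⟨(E.ker ⊔ P).index, ?_, ?_⟩
  · rw [hsup, Subgroup.index_comap, card_classGroup_eq_index O F]
    exact Subgroup.relIndex_dvd_index_of_normal _ _
  · have h1 : P.relIndex E.ker * (E.ker ⊔ P).index = P.index := by
      rw [← Subgroup.relIndex_sup_right E.ker P]
      exact Subgroup.relIndex_mul_index le_sup_right
    have h2 : (unitsIn R F).relIndex (unitsIn O F) = Nat.card (E.ker ⊓ P : Subgroup _) := by
      rw [hinf, ← ker_principalHom R F, Subgroup.relIndex_ker]
    have h3 : Nat.card (E.ker ⊓ P : Subgroup _) * P.relIndex E.ker = Nat.card E.ker := by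
      rw [← Subgroup.relIndex_bot_left, ← Subgroup.inf_relIndex_left E.ker P,
        Subgroup.relIndex_mul_relIndex _ _ _ bot_le inf_le_left, Subgroup.relIndex_bot_left]
    rw [card_classGroup_eq_index R F, h2, ← h1, ← h3]
    ring

variable {R F} (f : Ideal O)

/-- The preimage in `O ⊆ F` of the `R`-submodule of `O ⧸ f` generated by `u`. -/
noncomputable def liftSpan (u : O ⧸ f) : Submodule R F :=
  ((Submodule.span R {u}).comap (Ideal.Quotient.mkₐ R f).toLinearMap).map
    (IsScalarTower.toAlgHom R O F).toLinearMap

variable {O f}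

theorem mem_liftSpan {u : O ⧸ f} {z : F} : z ∈ liftSpan (R := R) O f u ↔
    ∃ y : O, (∃ r : R, Ideal.Quotient.mk f y = r • u) ∧ algebraMap O F y = z := by
  simp only [liftSpan, Submodule.mem_map, Submodule.mem_comap, Submodule.mem_span_singleton]
  constructor
  · rintro ⟨y, ⟨r, hr⟩, rfl⟩
    exact ⟨y, ⟨r, hr.symm⟩, rfl⟩
  · rintro ⟨y, ⟨r, hr⟩, rfl⟩
    exact ⟨y, ⟨r, hr.symm⟩, rfl⟩

theorem mem_liftSpan_of_mem {u : O ⧸ f} {y : O} (hy : y ∈ f) :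
    algebraMap O F y ∈ liftSpan (R := R) O f u :=
  mem_liftSpan.2 ⟨y, ⟨0, by rw [zero_smul, Ideal.Quotient.eq_zero_iff_mem]; exact hy⟩, rfl⟩

theorem mk_mem_liftSpan (y : O) :
    algebraMap O F y ∈ liftSpan (R := R) O f (Ideal.Quotient.mk f y) :=
  mem_liftSpan.2 ⟨y, ⟨1, (one_smul _ _).symm⟩, rfl⟩

theorem liftSpan_one (hf : ∀ x ∈ f, ∃ r : R, algebraMap R O r = x) :
    liftSpan (R := R) (F := F) O f 1 = 1 := by
  ext z
  rw [mem_liftSpan, Submodule.mem_one]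
  constructor
  · rintro ⟨y, ⟨r, hr⟩, rfl⟩
    rw [Algebra.smul_def, mul_one, IsScalarTower.algebraMap_apply R O (O ⧸ f),
      Ideal.Quotient.algebraMap_eq, Ideal.Quotient.mk_eq_mk_iff_sub_mem] at hr
    obtain ⟨s, hs⟩ := hf _ hr
    refine ⟨s + r, ?_⟩
    rw [IsScalarTower.algebraMap_apply R O F, map_add, hs, sub_add_cancel]
  · rintro ⟨r, rfl⟩
    refine ⟨algebraMap R O r, ⟨r, ?_⟩, (IsScalarTower.algebraMap_apply R O F r).symm⟩
    rw [Algebra.smul_def, mul_one, IsScalarTower.algebraMap_apply R O (O ⧸ f)]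
    rfl

theorem liftSpan_mul (u v : (O ⧸ f)ˣ) :
    liftSpan (R := R) (F := F) O f ((u * v : (O ⧸ f)ˣ) : O ⧸ f) =
      liftSpan O f (u : O ⧸ f) * liftSpan O f (v : O ⧸ f) := by
  apply le_antisymm
  · intro z hz
    obtain ⟨y, ⟨r, hr⟩, rfl⟩ := mem_liftSpan.1 hz
    obtain ⟨a, ha⟩ := Ideal.Quotient.mk_surjective (u : O ⧸ f)
    obtain ⟨a', ha'⟩ := Ideal.Quotient.mk_surjective ((u⁻¹ : (O ⧸ f)ˣ) : O ⧸ f)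
    obtain ⟨b, hb⟩ := Ideal.Quotient.mk_surjective (v : O ⧸ f)
    have h1 : y - algebraMap R O r * (a * b) ∈ f := by
      rw [← Ideal.Quotient.mk_eq_mk_iff_sub_mem, hr, map_mul, map_mul, ha, hb, Algebra.smul_def,
        Units.val_mul]
      rfl
    have h2 : 1 - a * a' ∈ f := by
      rw [← Ideal.Quotient.mk_eq_mk_iff_sub_mem, map_mul, ha, ha', Units.mul_inv, map_one]
    -- with `w ∈ f` and `a a' ≡ 1`, write `w = a (a' w) + (1 - a a') w`
    set w := y - algebraMap R O r * (a * b)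
    have hy : y = algebraMap R O r * (a * b) + (a * (a' * w) + (1 - a * a') * w) := by
      simp only [w]; ring
    have ma : algebraMap O F a ∈ liftSpan (R := R) O f (u : O ⧸ f) := ha ▸ mk_mem_liftSpan a
    have mb : algebraMap O F b ∈ liftSpan (R := R) O f (v : O ⧸ f) := hb ▸ mk_mem_liftSpan b
    rw [hy, map_add, map_add, map_mul, map_mul, map_mul, map_mul _ (1 - a * a'),
      ← IsScalarTower.algebraMap_apply R O F, ← Algebra.smul_def]
    refine add_mem (Submodule.smul_mem _ _ (Submodule.mul_mem_mul ma mb)) (add_mem ?_ ?_)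
    · exact Submodule.mul_mem_mul ma (mem_liftSpan_of_mem (f.mul_mem_left _ h1))
    · exact Submodule.mul_mem_mul (mem_liftSpan_of_mem h2) (mem_liftSpan_of_mem h1)
  · rw [Submodule.mul_le]
    intro x hx y hy
    obtain ⟨x, ⟨r, hr⟩, rfl⟩ := mem_liftSpan.1 hx
    obtain ⟨y, ⟨s, hs⟩, rfl⟩ := mem_liftSpan.1 hy
    refine mem_liftSpan.2 ⟨x * y, ⟨r * s, ?_⟩, map_mul _ _ _⟩
    rw [map_mul, hr, hs, Units.val_mul, smul_mul_smul_comm]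

/-- The homomorphism from `(O ⧸ f)ˣ` to the invertible `R`-submodules of `F`, for an ideal `f`
of `O` contained in `R`, given by `u ↦ R u + f`. -/
noncomputable def liftSpanHom (hf : ∀ x ∈ f, ∃ r : R, algebraMap R O r = x) :
    (O ⧸ f)ˣ →* (Submodule R F)ˣ :=
  MonoidHom.toHomUnits
    { toFun := fun u => liftSpan O f (u : O ⧸ f)
      map_one' := liftSpan_one hf
      map_mul' := liftSpan_mul }

theorem val_liftSpanHom (hf : ∀ x ∈ f, ∃ r : R, algebraMap R O r = x) (u : (O ⧸ f)ˣ) :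
    (liftSpanHom (F := F) hf u : Submodule R F) = liftSpan O f (u : O ⧸ f) := rfl

theorem ker_liftSpanHom [FaithfulSMul O F] (hf : ∀ x ∈ f, ∃ r : R, algebraMap R O r = x) :
    (liftSpanHom (F := F) hf).ker = (Units.map (Ideal.quotientMap f (algebraMap R O) le_rfl :
      R ⧸ f.comap (algebraMap R O) →* O ⧸ f)).range := by
  have hinj := FaithfulSMul.algebraMap_injective O F
  have key : ∀ u : (O ⧸ f)ˣ, liftSpanHom (F := F) hf u = 1 →
      ∃ r : R, Ideal.Quotient.mk f (algebraMap R O r) = u := by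
    intro u hu
    obtain ⟨a, ha⟩ := Ideal.Quotient.mk_surjective (u : O ⧸ f)
    have h := mk_mem_liftSpan (R := R) (F := F) (f := f) a
    rw [ha, ← val_liftSpanHom hf, hu, Units.val_one, Submodule.mem_one] at h
    obtain ⟨r, hr⟩ := h
    rw [IsScalarTower.algebraMap_apply R O F] at hr
    exact ⟨r, by rw [hinj hr, ha]⟩
  ext u
  constructor
  · intro hu
    obtain ⟨r, hr⟩ := key u hu
    obtain ⟨s, hs⟩ := key u⁻¹ (by rw [map_inv, MonoidHom.mem_ker.1 hu, inv_one])
    have hrs : Ideal.Quotient.mk (f.comap (algebraMap R O)) r *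
        Ideal.Quotient.mk (f.comap (algebraMap R O)) s = 1 := by
      apply Ideal.quotientMap_injective (I := f) (f := algebraMap R O)
      rw [map_mul, Ideal.quotientMap_mk, Ideal.quotientMap_mk, hr, hs, Units.mul_inv, map_one]
    exact ⟨⟨_, _, hrs, by rw [mul_comm, hrs]⟩, Units.ext hr⟩
  · rintro ⟨v, rfl⟩
    apply Units.ext
    rw [val_liftSpanHom, Units.val_one, ← liftSpan_one hf]
    obtain ⟨r, hr⟩ := Ideal.Quotient.mk_surjective (v : R ⧸ f.comap (algebraMap R O))
    obtain ⟨s, hs⟩ := Ideal.Quotient.mk_surjective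
      ((v⁻¹ : (R ⧸ f.comap (algebraMap R O))ˣ) : R ⧸ f.comap (algebraMap R O))
    have hv : ((Units.map (Ideal.quotientMap f (algebraMap R O) le_rfl :
      R ⧸ f.comap (algebraMap R O) →* O ⧸ f) v : (O ⧸ f)ˣ) : O ⧸ f) = r • (1 : O ⧸ f) := by
      rw [Units.coe_map, ← hr, Algebra.smul_def, mul_one]; rfl
    have hv' : (1 : O ⧸ f) = s • ((Units.map (Ideal.quotientMap f (algebraMap R O) le_rfl :
      R ⧸ f.comap (algebraMap R O) →* O ⧸ f) v : (O ⧸ f)ˣ) : O ⧸ f) := by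
      have : (Ideal.quotientMap f (algebraMap R O) le_rfl)
          (((v⁻¹ : (R ⧸ f.comap (algebraMap R O))ˣ) : R ⧸ f.comap (algebraMap R O)) * v) = 1 := by
        rw [Units.inv_mul, map_one]
      rw [Units.coe_map, Algebra.smul_def, ← this, map_mul, ← hs]; rfl
    ext z
    simp only [mem_liftSpan]
    constructor
    · rintro ⟨y, ⟨a, ha⟩, rfl⟩
      exact ⟨y, ⟨a * r, by rw [ha, hv, smul_smul]⟩, rfl⟩
    · rintro ⟨y, ⟨a, ha⟩, rfl⟩
      exact ⟨y, ⟨a * s, by rw [ha, mul_smul, ← hv']⟩, rfl⟩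

end ExactSequence

/-! ### Invertible modules that become trivial over the larger ring -/

section SemilocalGenerator

variable {R O F : Type*} [CommRing R] [CommRing O] [Field F] [Algebra R O] [Algebra R F]
  [Algebra O F] [IsScalarTower R O F]

/-- An invertible submodule `I` has an element `v` of its inverse such that `v I` lies outside each
of finitely many given maximal ideals; this is how invertible modules are shown to be free over
semilocal rings. -/
theorem exists_mem_inv_mul_notMem [FaithfulSMul R F] {s : Set (Ideal R)} (hs : s.Finite)
    (hmax : ∀ M ∈ s, M.IsMaximal) (I J : Submodule R F) (hIJ : I * J = 1) :
    ∃ v ∈ J, ∀ M ∈ s, ∃ a ∈ I, ∀ c ∈ M, algebraMap R F c ≠ a * v := by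
  classical
  have hinj := FaithfulSMul.algebraMap_injective R F
  have hmul : ∀ a ∈ I, ∀ b ∈ J, ∃ c, algebraMap R F c = a * b := fun a ha b hb =>
    Submodule.mem_one.1 (hIJ ▸ Submodule.mul_mem_mul ha hb)
  have hex : ∀ M ∈ s, ∃ a ∈ I, ∃ b ∈ J, a * b ∉ IsLocalization.coeSubmodule F M := by
    intro M hM
    by_contra! h
    have h1 : (1 : F) ∈ I * J := hIJ ▸ Submodule.one_le.1 le_rfl
    obtain ⟨c, hc, hc1⟩ := Submodule.mul_le.2 h h1
    have : c = 1 := hinj (by rw [map_one]; exact hc1)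
    exact (hmax M hM).ne_top ((Ideal.eq_top_iff_one M).2 (this ▸ hc))
  choose! a ha b hb hab using hex
  have hu : ∀ M ∈ s, ∃ u : R, u ∉ M ∧ ∀ M' ∈ s, M' ≠ M → u ∈ M' := by
    intro M hM
    have hnle : ¬ ⨅ M' ∈ hs.toFinset.erase M, M' ≤ M := by
      refine left_lt_sup.1 ((hmax M hM).lt_top.trans_eq (Ideal.sup_iInf_eq_top ?_).symm)
      intro M' hM'
      rw [Finset.mem_erase, hs.mem_toFinset] at hM'
      exact (hmax M hM).coprime_of_ne (hmax M' hM'.2) hM'.1.symm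
    obtain ⟨u, hu, huM⟩ := SetLike.not_le_iff_exists.1 hnle
    refine ⟨u, huM, fun M' hM' hne => ?_⟩
    simp_rw [Ideal.mem_iInf] at hu
    exact hu M' (Finset.mem_erase.2 ⟨hne, hs.mem_toFinset.2 hM'⟩)
  choose! u huM hu using hu
  refine ⟨∑ M ∈ hs.toFinset, u M • b M,
    sum_mem fun M hM => J.smul_mem _ (hb M (hs.mem_toFinset.1 hM)), fun M hM => ⟨a M, ha M hM, ?_⟩⟩
  intro c hc h
  have hmem : a M * ∑ M ∈ hs.toFinset, u M • b M ∈ IsLocalization.coeSubmodule F M := ⟨c, hc, h⟩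
  rw [Finset.mul_sum, ← Finset.add_sum_erase _ _ (hs.mem_toFinset.2 hM),
    Submodule.add_mem_iff_left] at hmem
  · obtain ⟨d, hd⟩ := hmul _ (ha M hM) _ (hb M hM)
    obtain ⟨e, he, hed⟩ := hmem
    have : e = u M * d := hinj (by
      rw [map_mul, hd, mul_left_comm, ← Algebra.smul_def]; exact hed)
    rw [SetLike.mem_coe, this] at he
    exact hab M hM ⟨d, ((hmax M hM).isPrime.mem_or_mem he).resolve_left (huM M hM), hd⟩
  · refine sum_mem fun M' hM' => ?_
    rw [Finset.mem_erase, hs.mem_toFinset] at hM'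
    obtain ⟨d, hd⟩ := hmul _ (ha M hM) _ (hb M' hM'.2)
    refine ⟨u M' * d, M.mul_mem_right _ (hu M' hM'.2 M hM hM'.1.symm), ?_⟩
    rw [Algebra.linearMap_apply, map_mul, hd, mul_left_comm, ← Algebra.smul_def]

theorem mul_mem_of_mem_span {f : Ideal O} (hf : ∀ x ∈ f, ∃ r : R, algebraMap R O r = x)
    {I : Submodule R F} {x : O} (hx : x ∈ f) {z : F} (hz : z ∈ Submodule.span O (I : Set F)) :
    algebraMap O F x * z ∈ I := by
  induction hz using Submodule.span_induction generalizing x with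
  | mem z hz =>
    obtain ⟨r, rfl⟩ := hf x hx
    rw [← IsScalarTower.algebraMap_apply, ← Algebra.smul_def]
    exact I.smul_mem _ hz
  | zero => rw [mul_zero]; exact zero_mem _
  | add y z _ _ hy hz => rw [mul_add]; exact add_mem (hy hx) (hz hx)
  | smul o z _ hz =>
    rw [Algebra.smul_def, ← mul_assoc, ← map_mul]
    exact hz (f.mul_mem_right _ hx)

theorem range_liftSpanHom [FaithfulSMul R F] [FaithfulSMul O F] {f : Ideal O} [Finite (O ⧸ f)]
    (hf : ∀ x ∈ f, ∃ r : R, algebraMap R O r = x) :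
    (liftSpanHom (F := F) hf).range = locallyTrivial R O F := by
  have hinj := FaithfulSMul.algebraMap_injective R F
  have hinjO := FaithfulSMul.algebraMap_injective O F
  apply le_antisymm
  · rintro _ ⟨u, rfl⟩
    rw [MonoidHom.mem_ker]
    apply Units.ext
    rw [Units.coe_map, extendScalarsHom_apply, val_liftSpanHom, Units.val_one]
    apply le_antisymm
    · rw [Submodule.span_le]
      intro z hz
      obtain ⟨y, -, rfl⟩ := mem_liftSpan.1 hz
      exact Submodule.mem_one.2 ⟨y, rfl⟩
    · obtain ⟨a, ha⟩ := Ideal.Quotient.mk_surjective (u : O ⧸ f)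
      obtain ⟨a', ha'⟩ := Ideal.Quotient.mk_surjective ((u⁻¹ : (O ⧸ f)ˣ) : O ⧸ f)
      have h2 : 1 - a' * a ∈ f := by
        rw [← Ideal.Quotient.mk_eq_mk_iff_sub_mem, map_mul, ha, ha', Units.inv_mul, map_one]
      have h1 : (1 : F) = a' • algebraMap O F a + algebraMap O F (1 - a' * a) := by
        rw [Algebra.smul_def, ← map_mul, ← map_add, add_sub_cancel, map_one]
      rw [Submodule.one_le, h1]
      exact add_mem (Submodule.smul_mem _ _ (Submodule.subset_span (ha ▸ mk_mem_liftSpan a)))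
        (Submodule.subset_span (mem_liftSpan_of_mem h2))
  · intro I hI
    have hspan : ∀ J ∈ locallyTrivial R O F,
        Submodule.span O ((J : Submodule R F) : Set F) = 1 := fun J hJ =>
      congrArg Units.val (MonoidHom.mem_ker.1 hJ)
    have hle : ∀ J ∈ locallyTrivial R O F, ∀ z ∈ (J : Submodule R F),
        ∃ y, algebraMap O F y = z := fun J hJ z hz =>
      Submodule.mem_one.1 (hspan J hJ ▸ Submodule.subset_span hz)
    have hIinv := inv_mem hI
    have hIJ : (I : Submodule R F) * ((I⁻¹ : (Submodule R F)ˣ) : Submodule R F) = 1 := I.mul_inv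
    set f' : Ideal R := f.comap (algebraMap R O)
    have hfin : Finite (R ⧸ f') :=
      Finite.of_injective _ (Ideal.quotientMap_injective (I := f) (f := algebraMap R O))
    have hs : {M : Ideal R | M.IsMaximal ∧ f' ≤ M}.Finite := by
      have hfin' : Finite (Ideal (R ⧸ f')) :=
        Finite.of_injective (fun I : Ideal (R ⧸ f') => (I : Set (R ⧸ f'))) SetLike.coe_injective
      refine Set.Finite.subset (Set.finite_range (Ideal.comap (Ideal.Quotient.mk f'))) ?_
      rintro M ⟨-, hM⟩
      refine ⟨M.map (Ideal.Quotient.mk f'), ?_⟩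
      rw [Ideal.comap_map_of_surjective _ Ideal.Quotient.mk_surjective, ← RingHom.ker_eq_comap_bot,
        Ideal.mk_ker, sup_eq_left]
      exact hM
    obtain ⟨v, hv, hvM⟩ := exists_mem_inv_mul_notMem hs (fun M hM => hM.1) _ _ hIJ
    -- the ideal `v I` of `R` is coprime to `f'`
    set 𝔞 : Ideal R := (((I : Submodule R F).map (LinearMap.mulLeft R v)).comap
      (Algebra.linearMap R F))
    have htop : 𝔞 ⊔ f' = ⊤ := by
      by_contra hne
      obtain ⟨M, hM, hJM⟩ := Ideal.exists_le_maximal _ hne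
      obtain ⟨a, ha, hac⟩ := hvM M ⟨hM, le_sup_right.trans hJM⟩
      obtain ⟨c, hc⟩ := Submodule.mem_one.1 (hIJ ▸ Submodule.mul_mem_mul ha hv)
      refine hac c (hJM (Ideal.mem_sup_left ⟨a, ha, ?_⟩)) hc
      rw [LinearMap.mulLeft_apply, Algebra.linearMap_apply, hc, mul_comm]
    obtain ⟨c, ⟨a, ha, hac⟩, t, ht, hct⟩ := Submodule.mem_sup.1
      ((Ideal.eq_top_iff_one _).1 htop)
    rw [LinearMap.mulLeft_apply, Algebra.linearMap_apply] at hac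
    have hvt : v * a + algebraMap R F t = 1 := by rw [hac, ← map_add, hct, map_one]
    obtain ⟨x, rfl⟩ := hle I hI a ha
    obtain ⟨y, rfl⟩ := hle _ hIinv v hv
    have htf : algebraMap R O t ∈ f := ht
    have hyx : y * x + algebraMap R O t = 1 := hinjO (by
      rw [map_add, map_mul, map_one, ← IsScalarTower.algebraMap_apply, hvt])
    have hunit : Ideal.Quotient.mk f y * Ideal.Quotient.mk f x = 1 := by
      rw [← map_mul, ← map_one (Ideal.Quotient.mk f), Ideal.Quotient.mk_eq_mk_iff_sub_mem,
        ← hyx, sub_add_cancel_left]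
      exact neg_mem htf
    have hIone : (1 : F) ∈ Submodule.span O ((I : Submodule R F) : Set F) := by
      rw [hspan I hI]; exact Submodule.one_le.1 le_rfl
    refine ⟨⟨Ideal.Quotient.mk f x, Ideal.Quotient.mk f y, by rw [mul_comm, hunit], hunit⟩, ?_⟩
    apply Units.ext
    rw [val_liftSpanHom]
    apply le_antisymm
    · intro z hz
      obtain ⟨w, ⟨r, hr⟩, rfl⟩ := mem_liftSpan.1 hz
      have hw : w - algebraMap R O r * x ∈ f := by
        rw [← Ideal.Quotient.mk_eq_mk_iff_sub_mem, hr, map_mul, Algebra.smul_def]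
        rfl
      have h1 : algebraMap O F w =
          r • algebraMap O F x + algebraMap O F (w - algebraMap R O r * x) * 1 := by
        rw [Algebra.smul_def, IsScalarTower.algebraMap_apply R O F, mul_one, ← map_mul, ← map_add,
          add_sub_cancel]
      rw [h1]
      exact add_mem (Submodule.smul_mem _ _ ha) (mul_mem_of_mem_span hf hw hIone)
    · intro z hz
      obtain ⟨w, rfl⟩ := hle I hI z hz
      obtain ⟨d, hd⟩ := Submodule.mem_one.1 (hIJ ▸ Submodule.mul_mem_mul hz hv)
      have h1 : algebraMap O F w =
          d • algebraMap O F x + algebraMap O F (algebraMap R O t * w) := by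
        rw [Algebra.smul_def, hd, ← map_mul, ← map_mul, ← map_add]
        congr 1
        calc w = w * (y * x + algebraMap R O t) := by rw [hyx, mul_one]
          _ = _ := by ring
      rw [h1]
      exact add_mem (Submodule.smul_mem _ _ (mk_mem_liftSpan x))
        (mem_liftSpan_of_mem (f.mul_mem_right _ htf))

theorem card_locallyTrivial_mul_card_units [FaithfulSMul R F] [FaithfulSMul O F] {f : Ideal O}
    [Finite (O ⧸ f)] (hf : ∀ x ∈ f, ∃ r : R, algebraMap R O r = x) :
    Nat.card (locallyTrivial R O F) * Nat.card (R ⧸ f.comap (algebraMap R O))ˣ =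
      Nat.card (O ⧸ f)ˣ := by
  have h := (liftSpanHom (F := F) hf).ker.card_mul_index
  rw [Subgroup.index_ker, range_liftSpanHom hf, ker_liftSpanHom hf,
    Nat.card_congr (MonoidHom.ofInjective (f := Units.map
      (Ideal.quotientMap f (algebraMap R O) le_rfl :
        R ⧸ f.comap (algebraMap R O) →* O ⧸ f)) ?_).toEquiv.symm] at h
  · rw [← h, mul_comm]
  · exact Units.map_injective Ideal.quotientMap_injective

end SemilocalGenerator

/-! ### The proportion of units in a finite ring -/

section FiniteRings

/-- Among `k` distinct integers `≥ 2` the `i`-th smallest is at least `i + 1`, so that the product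
telescopes. -/
theorem inv_card_add_one_le_prod (s : Finset ℕ) (hs : ∀ p ∈ s, 2 ≤ p) :
    ((s.card : ℝ) + 1)⁻¹ ≤ ∏ p ∈ s, (1 - (p : ℝ)⁻¹) := by
  induction s using Finset.induction_on_max with
  | empty => simp
  | insert a s ha ih =>
    have has : a ∉ s := fun h => lt_irrefl _ (ha a h)
    rw [Finset.prod_insert has, Finset.card_insert_of_notMem has]
    have ih := ih fun p hp => hs p (Finset.mem_insert_of_mem hp)
    have hcard : s.card + 2 ≤ a := by
      have h2 : 2 ≤ a := hs a (Finset.mem_insert_self _ _)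
      have hsub : s ⊆ Finset.Ico 2 a := fun p hp =>
        Finset.mem_Ico.2 ⟨hs p (Finset.mem_insert_of_mem hp), ha p hp⟩
      have := Finset.card_le_card hsub
      rw [Nat.card_Ico] at this
      omega
    have hcard' : (s.card : ℝ) + 2 ≤ a := by exact_mod_cast hcard
    have h0 : (0 : ℝ) ≤ s.card := Nat.cast_nonneg _
    calc (((s.card + 1 : ℕ) : ℝ) + 1)⁻¹ = (1 - ((s.card : ℝ) + 2)⁻¹) * ((s.card : ℝ) + 1)⁻¹ := by
          push_cast
          field_simp
          ring
      _ ≤ (1 - (a : ℝ)⁻¹) * ∏ p ∈ s, (1 - (p : ℝ)⁻¹) := by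
          have h1 : (a : ℝ)⁻¹ ≤ ((s.card : ℝ) + 2)⁻¹ := inv_anti₀ (by positivity) hcard'
          have h2 : ((s.card : ℝ) + 2)⁻¹ ≤ 1 := inv_le_one_of_one_le₀ (by linarith)
          gcongr
          linarith

theorem card_mul_card_units_le {A B : Type*} [CommRing A] [CommRing B] [Finite A] [Finite B]
    (π : A →+* B) (hπ : Function.Surjective π) (hu : ∀ a, IsUnit (π a) → IsUnit a) :
    Nat.card A * Nat.card Bˣ ≤ Nat.card Aˣ * Nat.card B := by
  obtain ⟨g, hg⟩ := hπ.hasRightInverse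
  have hval : ∀ x : A × Bˣ, π (g x.2 + (x.1 - g (π x.1))) = x.2 := fun x => by
    rw [map_add, map_sub, hg, hg, sub_self, add_zero]
  have hunit : ∀ x : A × Bˣ, IsUnit (g x.2 + (x.1 - g (π x.1))) := fun x =>
    hu _ (by rw [hval]; exact x.2.isUnit)
  rw [← Nat.card_prod, ← Nat.card_prod]
  refine Nat.card_le_card_of_injective
    (fun x : A × Bˣ => ((hunit x).unit, π x.1)) ?_
  intro x y h
  simp only [Prod.mk.injEq] at h
  obtain ⟨h1, h2⟩ := h
  have h1 : g x.2 + (x.1 - g (π x.1)) = g y.2 + (y.1 - g (π y.1)) := congrArg Units.val h1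
  have h3 : x.2 = y.2 := by
    apply Units.ext
    rw [← hval x, h1, hval]
  rw [h2, h3] at h1
  have h1 := add_left_cancel h1
  exact Prod.ext (sub_left_injective h1) h3

theorem card_le_pow_of_span_int {C : Type*} [AddCommGroup C] {d p : ℕ} (hp : 0 < p)
    (hpC : ∀ c : C, p • c = 0) (v : Fin d → C) (hv : Submodule.span ℤ (Set.range v) = ⊤) :
    Nat.card C ≤ p ^ d := by
  have hsurj : Function.Surjective (fun f : Fin d → Fin p => ∑ i, (f i : ℕ) • v i) := by
    intro c
    obtain ⟨n, hn⟩ := (Submodule.mem_span_range_iff_exists_fun ℤ).1 (hv ▸ Submodule.mem_top (x := c))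
    have hp' : (0 : ℤ) < p := by exact_mod_cast hp
    refine ⟨fun i => ⟨(n i % p).toNat, ?_⟩, ?_⟩
    · have := Int.emod_lt_of_pos (n i) hp'
      have := Int.emod_nonneg (n i) hp'.ne'
      omega
    · rw [← hn]
      refine Finset.sum_congr rfl fun i _ => ?_
      have h1 : (((n i % p).toNat : ℕ) : ℤ) = n i % p :=
        Int.toNat_of_nonneg (Int.emod_nonneg _ hp'.ne')
      have h2 : ((p : ℤ) * (n i / p)) • v i = 0 := by
        rw [mul_smul, natCast_zsmul, hpC]
      show (n i % p).toNat • v i = n i • v i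
      rw [← natCast_zsmul, h1]
      conv_rhs => rw [← Int.emod_add_mul_ediv (n i) p, add_smul, h2, add_zero]
  have := Nat.card_le_card_of_surjective _ hsurj
  simpa using this

/-- In a finite commutative ring killed by `m` and generated by `d` elements as an abelian group,
there are at most `d` maximal ideals over each prime divisor of `m`, which bounds from below
the proportion of units. -/
theorem card_le_card_units_mul {A : Type*} [CommRing A] [Finite A] {d m : ℕ} (hm : m ≠ 0)
    (hmA : (m : A) = 0) (v : Fin d → A) (hv : Submodule.span ℤ (Set.range v) = ⊤) :
    (Nat.card A : ℝ) ≤ Nat.card Aˣ * ((m.primeFactors.card : ℝ) + 1) ^ d := by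
  classical
  have hfin : Finite (Ideal A) :=
    Finite.of_injective (fun I : Ideal A => (I : Set A)) SetLike.coe_injective
  have hfinM : Finite (MaximalSpectrum A) :=
    Finite.of_injective (fun M : MaximalSpectrum A => M.asIdeal)
      fun M N h => MaximalSpectrum.ext h
  have := Fintype.ofFinite (MaximalSpectrum A)
  have hfinq : ∀ M : MaximalSpectrum A, Finite (A ⧸ M.asIdeal) := fun M =>
    Finite.of_surjective _ Ideal.Quotient.mk_surjective
  let π : A →+* ∀ M : MaximalSpectrum A, A ⧸ M.asIdeal :=
    RingHom.pi fun M => Ideal.Quotient.mk M.asIdeal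
  have hπ : Function.Surjective π := by
    intro b
    obtain ⟨a, ha⟩ := Ideal.quotientInfToPiQuotient_surj
      (I := fun M : MaximalSpectrum A => M.asIdeal)
      (fun M N h => Ideal.isCoprime_of_isMaximal fun h' => h (MaximalSpectrum.ext h')) b
    obtain ⟨a, rfl⟩ := Ideal.Quotient.mk_surjective a
    exact ⟨a, ha⟩
  have hu : ∀ a, IsUnit (π a) → IsUnit a := by
    intro a ha
    by_contra hna
    obtain ⟨M, hM, haM⟩ := exists_max_ideal_of_mem_nonunits hna
    have h0 : π a ⟨M, hM⟩ = 0 := Ideal.Quotient.eq_zero_iff_mem.2 haM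
    have h1 := ha.map (Pi.evalRingHom (fun M : MaximalSpectrum A => A ⧸ M.asIdeal) ⟨M, hM⟩)
    rw [Pi.evalRingHom_apply, h0] at h1
    have : Nontrivial (A ⧸ M) := Ideal.Quotient.nontrivial_iff.2 hM.ne_top
    exact not_isUnit_zero h1
  have hmain := card_mul_card_units_le π hπ hu
  let N : MaximalSpectrum A → ℕ := fun M => Nat.card (A ⧸ M.asIdeal)
  have hN2 : ∀ M, 2 ≤ N M := fun M => by
    have : Nontrivial (A ⧸ M.asIdeal) := Ideal.Quotient.nontrivial_iff.2 M.isMaximal.ne_top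
    exact Finite.one_lt_card
  have hcardB : Nat.card (∀ M : MaximalSpectrum A, A ⧸ M.asIdeal) = ∏ M, N M := Nat.card_pi
  have hcardU : Nat.card (∀ M : MaximalSpectrum A, A ⧸ M.asIdeal)ˣ = ∏ M, (N M - 1) := by
    rw [Nat.card_congr MulEquiv.piUnits.toEquiv, Nat.card_pi]
    refine Finset.prod_congr rfl fun M _ => ?_
    let := Ideal.Quotient.field M.asIdeal
    exact Nat.card_units _
  let p : MaximalSpectrum A → ℕ := fun M => ringChar (A ⧸ M.asIdeal)
  have hp : ∀ M, (p M).Prime := fun M => by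
    let := Ideal.Quotient.field M.asIdeal
    exact CharP.char_is_prime (A ⧸ M.asIdeal) (p M)
  have hpm : ∀ M, p M ∈ m.primeFactors := fun M => by
    refine Nat.mem_primeFactors.2 ⟨hp M, ?_, hm⟩
    refine ringChar.dvd ?_
    rw [← map_natCast (Ideal.Quotient.mk M.asIdeal), hmA, map_zero]
  have hpN : ∀ M, p M ≤ N M := fun M => by
    let := Ideal.Quotient.field M.asIdeal
    refine Nat.le_of_dvd Nat.card_pos ?_
    refine ringChar.dvd ?_
    have := Fintype.ofFinite (A ⧸ M.asIdeal)
    simp only [N, Nat.card_eq_fintype_card]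
    exact Nat.cast_card_eq_zero _
  have hcount : ∀ r ∈ m.primeFactors, (Finset.univ.filter fun M => p M = r).card ≤ d := by
    intro r hr
    have hr' := (Nat.mem_primeFactors.1 hr).1
    let T := {M : MaximalSpectrum A // p M = r}
    let ρ : A →+* ∀ M : T, A ⧸ M.1.asIdeal := RingHom.pi fun M => Ideal.Quotient.mk M.1.asIdeal
    have hρ : Function.Surjective ρ := by
      intro b
      obtain ⟨a, ha⟩ := hπ fun M => if h : p M = r then b ⟨M, h⟩ else 0
      refine ⟨a, funext fun M => ?_⟩
      have := congrFun ha M.1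
      rw [dif_pos M.2] at this
      exact this
    have hle := card_le_pow_of_span_int (C := ∀ M : T, A ⧸ M.1.asIdeal) (d := d) hr'.pos
      (fun c => funext fun M => by
        have : ((p M.1 : ℕ) : A ⧸ M.1.asIdeal) = 0 := ringChar.Nat.cast_ringChar
        rw [M.2] at this
        rw [Pi.smul_apply, nsmul_eq_mul, this, zero_mul, Pi.zero_apply])
      (fun i => ρ (v i)) (by
        have h := congrArg (Submodule.map ρ.toAddMonoidHom.toIntLinearMap) hv
        rw [Submodule.map_span, Submodule.map_top, LinearMap.range_eq_top.2 hρ, ← Set.range_comp]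
          at h
        exact h)
    rw [Nat.card_pi] at hle
    have h2 : r ^ Fintype.card T ≤ ∏ M : T, Nat.card (A ⧸ M.1.asIdeal) := by
      rw [← Finset.card_univ, ← Finset.prod_const]
      exact Finset.prod_le_prod' fun M _ => by
        have := hpN M.1
        rwa [M.2] at this
    rw [← Fintype.card_subtype]
    exact (Nat.pow_le_pow_iff_right hr'.one_lt).1 (h2.trans hle)
  have hprod : (((m.primeFactors.card : ℝ) + 1) ^ d)⁻¹ ≤ ∏ M, (1 - (N M : ℝ)⁻¹) := by
    have hr01 : ∀ r ∈ m.primeFactors, 0 ≤ 1 - (r : ℝ)⁻¹ ∧ 1 - (r : ℝ)⁻¹ ≤ 1 := by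
      intro r hr
      have h1 : (1 : ℝ) ≤ r := by exact_mod_cast (Nat.mem_primeFactors.1 hr).1.one_lt.le
      exact ⟨by linarith [inv_le_one_of_one_le₀ h1], by
        linarith [inv_nonneg.2 (zero_le_one.trans h1)]⟩
    calc (((m.primeFactors.card : ℝ) + 1) ^ d)⁻¹ = (((m.primeFactors.card : ℝ) + 1)⁻¹) ^ d := by
          rw [inv_pow]
      _ ≤ (∏ r ∈ m.primeFactors, (1 - (r : ℝ)⁻¹)) ^ d := by
          gcongr
          exact inv_card_add_one_le_prod _ fun r hr => (Nat.mem_primeFactors.1 hr).1.two_le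
      _ = ∏ r ∈ m.primeFactors, (1 - (r : ℝ)⁻¹) ^ d := (Finset.prod_pow _ _ _).symm
      _ ≤ ∏ r ∈ m.primeFactors, (1 - (r : ℝ)⁻¹) ^ (Finset.univ.filter fun M => p M = r).card :=
          Finset.prod_le_prod (fun r hr => pow_nonneg (hr01 r hr).1 _) fun r hr =>
            pow_le_pow_of_le_one (hr01 r hr).1 (hr01 r hr).2 (hcount r hr)
      _ = ∏ r ∈ m.primeFactors, ∏ M ∈ Finset.univ.filter fun M => p M = r, (1 - (p M : ℝ)⁻¹) := by
          refine Finset.prod_congr rfl fun r _ => ?_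
          rw [← Finset.prod_const]
          exact Finset.prod_congr rfl fun M hM => by rw [(Finset.mem_filter.1 hM).2]
      _ = ∏ M, (1 - (p M : ℝ)⁻¹) :=
          Finset.prod_fiberwise_of_maps_to (fun M _ => hpm M) fun M => (1 - (p M : ℝ)⁻¹)
      _ ≤ ∏ M, (1 - (N M : ℝ)⁻¹) := by
          refine Finset.prod_le_prod (fun M _ => (hr01 _ (hpm M)).1) fun M _ => ?_
          have : (0 : ℝ) < p M := by exact_mod_cast (hp M).pos
          have h : (p M : ℝ) ≤ N M := by exact_mod_cast hpN M
          gcongr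
  have hNpos : ∀ M, (0 : ℝ) < N M := fun M => by
    have := hN2 M
    exact_mod_cast (by omega : 0 < N M)
  have hB : (0 : ℝ) < ∏ M, (N M : ℝ) := Finset.prod_pos fun M _ => hNpos M
  have hratio : (∏ M, (1 - (N M : ℝ)⁻¹)) * ∏ M, (N M : ℝ) = ((∏ M, (N M - 1) : ℕ) : ℝ) := by
    rw [← Finset.prod_mul_distrib, Nat.cast_prod]
    refine Finset.prod_congr rfl fun M _ => ?_
    have := hN2 M
    have := (hNpos M).ne'
    rw [Nat.cast_sub (by omega), sub_mul, inv_mul_cancel₀ this]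
    simp
  have hmain' : (Nat.card A : ℝ) * ((∏ M, (N M - 1) : ℕ) : ℝ) ≤
      Nat.card Aˣ * ∏ M, (N M : ℝ) := by
    rw [hcardB, hcardU] at hmain
    have := (Nat.cast_le (α := ℝ)).2 hmain
    push_cast at this ⊢
    exact this
  rw [← hratio, ← mul_assoc] at hmain'
  have h3 := le_of_mul_le_mul_right hmain' hB
  have hpos : (0 : ℝ) < ((m.primeFactors.card : ℝ) + 1) ^ d := by positivity
  rw [← div_le_iff₀ hpos, div_eq_mul_inv]
  exact (mul_le_mul_of_nonneg_left hprod (Nat.cast_nonneg _)).trans h3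

end FiniteRings

/-! ### Class numbers of orders in number fields -/

section Orders

open NumberField

theorem exists_span_quotient_eq_top {A : Type*} [CommRing A] {d : ℕ} (b : Module.Basis (Fin d) ℤ A)
    (I : Ideal A) : ∃ v : Fin d → A ⧸ I, Submodule.span ℤ (Set.range v) = ⊤ := by
  refine ⟨fun i => Ideal.Quotient.mk I (b i), ?_⟩
  have h := congrArg (Submodule.map (Ideal.Quotient.mk I).toAddMonoidHom.toIntLinearMap) b.span_eq
  rw [Submodule.map_span, Submodule.map_top,
    LinearMap.range_eq_top.2 Ideal.Quotient.mk_surjective, ← Set.range_comp] at h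
  exact h

/-- For an order `R` of index `m` in the maximal order, with unit index `e`, the product
`# ClassGroup R * e` equals `m` up to a factor that is polynomial in the number of prime divisors
of `m`. -/
theorem card_classGroup_mul_relIndex_bounds {F : Type*} [Field F] [NumberField F] (R : Type*)
    [CommRing R] [IsDomain R] [Algebra R (𝓞 F)] [Algebra R F] [IsScalarTower R (𝓞 F) F]
    [IsFractionRing R F] {d m : ℕ} (hd : Module.finrank ℚ F = d) (b : Module.Basis (Fin d) ℤ R)
    (hm : (algebraMap R (𝓞 F)).toAddMonoidHom.range.index = m) (hm0 : m ≠ 0) :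
    (Nat.card (ClassGroup R) : ℝ) * ((unitsIn R F).relIndex (unitsIn (𝓞 F) F) : ℝ) ≤
        Nat.card (ClassGroup (𝓞 F)) * (m * ((m.primeFactors.card : ℝ) + 1) ^ d) ∧
      (m : ℝ) ≤ (Nat.card (ClassGroup R) : ℝ) *
        ((unitsIn R F).relIndex (unitsIn (𝓞 F) F) : ℝ) * ((m.primeFactors.card : ℝ) + 1) ^ d := by
  have hR : FaithfulSMul R F := (faithfulSMul_iff_algebraMap_injective R F).2
    (IsFractionRing.injective R F)
  set f : Ideal (𝓞 F) := Ideal.span {(m : 𝓞 F)} with hf_def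
  set f' : Ideal R := f.comap (algebraMap R (𝓞 F)) with hf'_def
  have hf0 : f ≠ ⊥ := by
    rw [hf_def, Ne, Ideal.span_singleton_eq_bot]
    exact_mod_cast hm0
  have hfinO : Finite (𝓞 F ⧸ f) := Ring.HasFiniteQuotients.finiteQuotient hf0
  have hfinR : Finite (R ⧸ f') :=
    Finite.of_injective _ (Ideal.quotientMap_injective (I := f) (f := algebraMap R (𝓞 F)))
  have hf : ∀ x ∈ f, ∃ r : R, algebraMap R (𝓞 F) r = x := by
    intro x hx
    obtain ⟨y, rfl⟩ := Ideal.mem_span_singleton'.1 hx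
    have := AddSubgroup.nsmul_index_mem (algebraMap R (𝓞 F)).toAddMonoidHom.range y
    rw [hm, nsmul_eq_mul, mul_comm] at this
    exact this
  have hcard : Nat.card (𝓞 F ⧸ f) = Nat.card (R ⧸ f') * m := by
    have h1 : f.toAddSubgroup ≤ (algebraMap R (𝓞 F)).toAddMonoidHom.range := hf
    have h2 := AddSubgroup.relIndex_mul_index h1
    rw [← AddSubgroup.index_comap, hm] at h2
    exact h2.symm
  have hmO : ((m : ℕ) : 𝓞 F ⧸ f) = 0 := by
    rw [← map_natCast (Ideal.Quotient.mk f), Ideal.Quotient.eq_zero_iff_mem]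
    exact Ideal.mem_span_singleton_self _
  have hmR : ((m : ℕ) : R ⧸ f') = 0 := by
    rw [← map_natCast (Ideal.Quotient.mk f'), Ideal.Quotient.eq_zero_iff_mem, hf'_def,
      Ideal.mem_comap, map_natCast]
    exact Ideal.mem_span_singleton_self _
  have hbO : Nonempty (Module.Basis (Fin d) ℤ (𝓞 F)) := by
    have := Module.finBasis ℤ (𝓞 F)
    rw [RingOfIntegers.rank F, hd] at this
    exact ⟨this⟩
  obtain ⟨bO⟩ := hbO
  obtain ⟨vO, hvO⟩ := exists_span_quotient_eq_top bO f
  obtain ⟨vR, hvR⟩ := exists_span_quotient_eq_top b f'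
  have hO := card_le_card_units_mul hm0 hmO vO hvO
  have hRR := card_le_card_units_mul hm0 hmR vR hvR
  obtain ⟨c, hc, hk⟩ := card_classGroup_mul_relIndex R (𝓞 F) F
  have hku := card_locallyTrivial_mul_card_units (F := F) hf
  set L : ℝ := ((m.primeFactors.card : ℝ) + 1) ^ d
  have hL : 0 < L := by positivity
  set k := Nat.card (locallyTrivial R (𝓞 F) F)
  have hh : 0 < Nat.card (ClassGroup (𝓞 F)) := Nat.card_pos
  have hcle : c ≤ Nat.card (ClassGroup (𝓞 F)) := Nat.le_of_dvd hh hc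
  have hc1 : 1 ≤ c := Nat.pos_of_dvd_of_pos hc hh
  have huR : 0 < Nat.card (R ⧸ f')ˣ := Nat.card_pos
  have hR0 : 0 < Nat.card (R ⧸ f') := Nat.card_pos
  have huRle : Nat.card (R ⧸ f')ˣ ≤ Nat.card (R ⧸ f') :=
    Nat.card_le_card_of_injective _ Units.val_injective
  have huOle : Nat.card (𝓞 F ⧸ f)ˣ ≤ Nat.card (𝓞 F ⧸ f) :=
    Nat.card_le_card_of_injective _ Units.val_injective
  have hkR : (Nat.card (ClassGroup R) : ℝ) * ((unitsIn R F).relIndex (unitsIn (𝓞 F) F) : ℝ) =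
      k * c := by exact_mod_cast hk
  have hkuR : (k : ℝ) * Nat.card (R ⧸ f')ˣ = Nat.card (𝓞 F ⧸ f)ˣ := by exact_mod_cast hku
  have hcardR : (Nat.card (𝓞 F ⧸ f) : ℝ) = Nat.card (R ⧸ f') * m := by exact_mod_cast hcard
  rify at huRle huOle huR hR0 hcle hc1
  have hk1 : (k : ℝ) ≤ m * L := by
    refine le_of_mul_le_mul_right ?_ huR
    calc (k : ℝ) * Nat.card (R ⧸ f')ˣ ≤ Nat.card (R ⧸ f') * m := by
          rw [hkuR, ← hcardR]; exact huOle
      _ ≤ Nat.card (R ⧸ f')ˣ * L * m := by gcongr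
      _ = m * L * Nat.card (R ⧸ f')ˣ := by ring
  have hk2 : (m : ℝ) ≤ k * L := by
    refine le_of_mul_le_mul_left ?_ hR0
    calc (Nat.card (R ⧸ f') : ℝ) * m ≤ Nat.card (𝓞 F ⧸ f)ˣ * L := by rw [← hcardR]; exact hO
      _ = k * Nat.card (R ⧸ f')ˣ * L := by rw [hkuR]
      _ ≤ k * Nat.card (R ⧸ f') * L := by gcongr
      _ = Nat.card (R ⧸ f') * (k * L) := by ring
  rw [hkR]
  constructor
  · calc (k : ℝ) * c ≤ (m * L) * Nat.card (ClassGroup (𝓞 F)) := by gcongr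
      _ = _ := by ring
  · calc (m : ℝ) ≤ k * 1 * L := by rw [mul_one]; exact hk2
      _ ≤ k * c * L := by gcongr

end Orders

/-! ### Narrow class groups -/

section Narrow

/-- The signs of a unit of a field under all real embeddings. -/
noncomputable def realSigns (F : Type*) [Field F] : Fˣ →* ((F →+* ℝ) → SignTypeˣ) :=
  MonoidHom.pi fun φ => Units.map
    (((signHom : ℝ →*₀ SignType) : ℝ →* SignType).comp (φ : F →* ℝ))

theorem ker_realSigns (F : Type*) [Field F] : (realSigns F).ker = totallyPositiveUnits F := by
  ext x
  rw [MonoidHom.mem_ker, funext_iff]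
  refine forall_congr' fun φ => ?_
  rw [← sign_eq_one_iff, Units.ext_iff]
  rfl

theorem index_totallyPositiveUnits (F : Type*) [Field F] [Finite (F →+* ℝ)] :
    (totallyPositiveUnits F).index ∣ 2 ^ Nat.card (F →+* ℝ) := by
  rw [← ker_realSigns, Subgroup.index_ker]
  have h : Nat.card ((F →+* ℝ) → SignTypeˣ) = 2 ^ Nat.card (F →+* ℝ) := by
    have h2 : Nat.card SignTypeˣ = 2 := by
      rw [Nat.card_units, Nat.card_eq_fintype_card]
      rfl
    rw [Nat.card_fun, h2]
  rw [← h]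
  exact Subgroup.card_subgroup_dvd_card _

theorem card_realEmbeddings_le {F K : Type*} [Field F] [Field K] [NumberField K] (i : F →+* K) :
    Finite (F →+* ℝ) ∧ Nat.card (F →+* ℝ) ≤ Module.finrank ℚ K := by
  have : CharZero F := i.charZero
  have hinj : Function.Injective i.toRatAlgHom.toLinearMap := i.injective
  have hfin : FiniteDimensional ℚ F := FiniteDimensional.of_injective _ hinj
  have : NumberField F := ⟨⟩
  have hinj' : Function.Injective (fun φ : F →+* ℝ => Complex.ofRealHom.comp φ) := fun φ ψ h =>
    RingHom.ext fun x => Complex.ofReal_injective (RingHom.congr_fun h x)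
  refine ⟨Finite.of_injective _ hinj', ?_⟩
  calc Nat.card (F →+* ℝ) ≤ Nat.card (F →+* ℂ) := Nat.card_le_card_of_injective _ hinj'
    _ = Module.finrank ℚ F := by
      rw [Nat.card_eq_fintype_card, NumberField.Embeddings.card]
    _ ≤ Module.finrank ℚ K := LinearMap.finrank_le_finrank_of_injective hinj

theorem card_narrowClassGroup (R : Type*) [CommRing R] [IsDomain R]
    [Finite (FractionRing R →+* ℝ)] :
    ∃ c : ℕ, c ∣ 2 ^ Nat.card (FractionRing R →+* ℝ) ∧
      Nat.card (NarrowClassGroup R) = c * Nat.card (ClassGroup R) := by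
  refine ⟨((totallyPositiveUnits (FractionRing R)).map
    (toPrincipalIdeal R (FractionRing R))).relIndex (toPrincipalIdeal R (FractionRing R)).range,
    ?_, ?_⟩
  · rw [MonoidHom.range_eq_map, Subgroup.relIndex_map_map, top_sup_eq, Subgroup.relIndex_top_right]
    exact (Subgroup.index_dvd_of_le le_sup_left).trans (index_totallyPositiveUnits _)
  · rw [← Subgroup.index_eq_card, ← Subgroup.relIndex_mul_index (Subgroup.map_le_range _ _)]
    rfl

/-- The narrow class number of an order contained in `K` is the class number up to a factor that
depends only on the degree of `K`. -/
theorem card_narrowClassGroup_bounds {R K : Type*} [CommRing R] [IsDomain R] [Field K]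
    [NumberField K] (i : R →+* K) (hi : Function.Injective i) :
    Nat.card (ClassGroup R) ≤ Nat.card (NarrowClassGroup R) ∧
      Nat.card (NarrowClassGroup R) ≤ 2 ^ Module.finrank ℚ K * Nat.card (ClassGroup R) := by
  obtain ⟨hfin, hle⟩ := card_realEmbeddings_le
    (IsFractionRing.lift (K := FractionRing R) (g := i) hi)
  obtain ⟨c, hc, h⟩ := card_narrowClassGroup R
  have hc1 : 1 ≤ c := Nat.pos_of_dvd_of_pos hc (by positivity)
  have hc2 : c ≤ 2 ^ Module.finrank ℚ K :=
    (Nat.le_of_dvd (by positivity) hc).trans (Nat.pow_le_pow_right (by norm_num) hle)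
  rw [h]
  exact ⟨Nat.le_mul_of_pos_left _ hc1, Nat.mul_le_mul_right _ hc2⟩

end Narrow

/-! ### Weil numbers generate CM fields -/

section WeilNumbers

open NumberField ComplexConjugate

variable {K : Type*} [Field K] [NumberField K] {q : ℕ} {α : K}

theorem ext_of_adjoin_simple_eq_top (h : ℚ⟮α⟯ = ⊤)
    {φ ψ : K →+* ℂ} (hφ : φ α = ψ α) : φ = ψ := by
  have h1 : φ.toRatAlgHom = ψ.toRatAlgHom :=
    (Field.primitive_element_iff_algHom_eq_of_eval' ℚ ℂ (fun x => IsAlgClosed.splits _) α).1 h hφ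
  exact RingHom.ext fun x => DFunLike.congr_fun h1 x

theorem IsWeilNumber.ne_zero (hα : IsWeilNumber q α) (hq : 0 < q) : α ≠ 0 := by
  rintro rfl
  obtain ⟨φ⟩ : Nonempty (K →+* ℂ) := inferInstance
  have h := hα.2 φ
  rw [map_zero, norm_zero] at h
  have : 0 < Real.sqrt q := Real.sqrt_pos.2 (by exact_mod_cast hq)
  exact this.ne h

theorem IsWeilNumber.conj_apply (hα : IsWeilNumber q α) (hq : 0 < q) (φ : K →+* ℂ) :
    conj (φ α) = φ (q / α) := by
  have h0 : φ α ≠ 0 := (map_ne_zero φ).2 (hα.ne_zero hq)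
  rw [map_div₀, map_natCast, eq_div_iff h0, Complex.conj_mul', hα.2 φ, ← Complex.ofReal_pow,
    Real.sq_sqrt (Nat.cast_nonneg q), Complex.ofReal_natCast]

theorem IsWeilNumber.exists_conj (hα : IsWeilNumber q α) (hq : 0 < q) (htop : ℚ⟮α⟯ = ⊤) :
    ∃ σ : K ≃ₐ[ℚ] K, ∀ φ : K →+* ℂ, ComplexEmbedding.IsConj φ σ := by
  obtain ⟨φ₀⟩ : Nonempty (K →+* ℂ) := inferInstance
  have hint : IsIntegral ℚ α := Algebra.IsIntegral.isIntegral α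
  have htop' : Algebra.adjoin ℚ {α} = ⊤ := by
    rw [← IntermediateField.adjoin_simple_toSubalgebra_of_isAlgebraic hint.isAlgebraic, htop,
      IntermediateField.top_toSubalgebra]
  let pb := PowerBasis.ofAdjoinEqTop' hint htop'
  have hgen : pb.gen = α := PowerBasis.ofAdjoinEqTop'_gen hint htop'
  have hroot : Polynomial.aeval ((q : K) / α) (minpoly ℚ pb.gen) = 0 := by
    have hinj : Function.Injective φ₀.toRatAlgHom := φ₀.injective
    apply hinj
    rw [← Polynomial.aeval_algHom_apply, map_zero]
    have h1 : φ₀.toRatAlgHom ((q : K) / α) =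
        ((starRingEnd ℂ).comp φ₀).toRatAlgHom α := (hα.conj_apply hq φ₀).symm
    rw [h1, Polynomial.aeval_algHom_apply, hgen, minpoly.aeval, map_zero]
  let σ : K →ₐ[ℚ] K := pb.lift _ hroot
  have hσ : σ α = q / α := by
    rw [← hgen]
    exact (pb.lift_gen _ hroot).trans (by rw [hgen])
  let σ' : K ≃ₐ[ℚ] K := AlgEquiv.ofBijective σ (Algebra.IsAlgebraic.algHom_bijective σ)
  refine ⟨σ', fun φ => ?_⟩
  refine ext_of_adjoin_simple_eq_top htop ?_
  show conj (φ α) = φ (σ α)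
  rw [hα.conj_apply hq, hσ]

theorem isTotallyComplex_of_isConj {σ : K ≃ₐ[ℚ] K} (hσ : ∀ φ : K →+* ℂ, ComplexEmbedding.IsConj φ σ)
    (hne : σ ≠ 1) : IsTotallyComplex K := by
  refine ⟨fun v => ?_⟩
  rw [← InfinitePlace.not_isReal_iff_isComplex, ← InfinitePlace.mk_embedding v,
    InfinitePlace.isReal_mk_iff]
  exact (ComplexEmbedding.isConj_ne_one_iff (hσ v.embedding)).1 hne

theorem isCMField_of_isConj {σ : K ≃ₐ[ℚ] K} (hσ : ∀ φ : K →+* ℂ, ComplexEmbedding.IsConj φ σ)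
    (hne : σ ≠ 1) : IsCMField K := by
  have := isTotallyComplex_of_isConj hσ hne
  let φ : K →+* ℂ := Classical.choice (inferInstance : Nonempty _)
  have hσ' : Nat.card (Subgroup.zpowers σ) = 2 := by
    rw [Nat.card_zpowers]
    exact ComplexEmbedding.orderOf_isConj_two_of_ne_one (hσ φ) hne
  let L : IntermediateField ℚ K := IntermediateField.fixedField (Subgroup.zpowers σ)
  have : IsTotallyReal L := ⟨fun w => by
    obtain ⟨W, rfl⟩ := w.comap_surjective (K := K)
    dsimp only
    rw [← InfinitePlace.mk_embedding W, InfinitePlace.comap_mk, InfinitePlace.isReal_mk_iff,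
      ComplexEmbedding.isReal_iff]
    ext x
    have h1 := ComplexEmbedding.IsConj.eq (hσ W.embedding) x
    have h2 : σ x = x := x.2 ⟨σ, Subgroup.mem_zpowers σ⟩
    rw [h2] at h1
    exact h1.symm⟩
  have : Algebra.IsQuadraticExtension L K := ⟨by
    rw [IntermediateField.finrank_fixedField_eq_card, hσ']⟩
  exact IsCMField.ofCMExtension L K

theorem IsWeilNumber.isCMField (hα : IsWeilNumber q α) (hq : 0 < q) {g : ℕ}
    (hg : Module.finrank ℚ K = 2 * g) (h1 : ℚ⟮α⟯ = ⊤) (h2 : ℚ⟮α ^ 2⟯ = ⊤) : IsCMField K := by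
  obtain ⟨σ, hσ⟩ := hα.exists_conj hq h1
  refine isCMField_of_isConj hσ ?_
  rintro rfl
  obtain ⟨φ₀⟩ : Nonempty (K →+* ℂ) := inferInstance
  -- if conjugation is trivial then `α ^ 2 = q` is rational
  have hα2 : α ^ 2 = q := by
    apply φ₀.injective
    have h := (hσ φ₀).eq α
    rw [AlgEquiv.one_apply] at h
    have h' := hα.conj_apply hq φ₀
    have : φ₀ α = φ₀ (q / α) := h.trans h'
    have := φ₀.injective this
    rw [eq_div_iff (hα.ne_zero hq)] at this
    rw [sq, this]
  have hbot : ℚ⟮α ^ 2⟯ = ⊥ := by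
    rw [IntermediateField.adjoin_simple_eq_bot_iff, hα2]
    exact natCast_mem _ q
  have h3 : (⊥ : IntermediateField ℚ K) = ⊤ := hbot.symm.trans h2
  have h4 := IntermediateField.finrank_bot (F := ℚ) (E := K)
  rw [h3, IntermediateField.finrank_top', hg] at h4
  omega

theorem IsWeilNumber.complexConj_eq [IsCMField K] (hα : IsWeilNumber q α) (hq : 0 < q) :
    IsCMField.complexConj K α = q / α := by
  obtain ⟨φ₀⟩ : Nonempty (K →+* ℂ) := inferInstance
  apply φ₀.injective
  rw [IsCMField.complexEmbedding_complexConj, hα.conj_apply hq]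

end WeilNumbers

/-! ### Indices of orders and discriminants -/

section OrderIndex

open NumberField

variable {F : Type*} [Field F] [NumberField F]

/-- The submodule of the ring of integers formed by the elements of a given subring. -/
noncomputable def integersIn (R : Subalgebra ℤ F) : Submodule ℤ (𝓞 F) :=
  (Subalgebra.toSubmodule R).comap (IsScalarTower.toAlgHom ℤ (𝓞 F) F).toLinearMap

/-- The index of an order in the ring of integers. -/
noncomputable def orderIndex (R : Subalgebra ℤ F) : ℕ := (integersIn R).toAddSubgroup.index

/-- A subring consisting of integers is linearly equivalent to its copy in `𝓞 F`. -/
noncomputable def integersInEquiv (R : Subalgebra ℤ F) (hR : ∀ x ∈ R, IsIntegral ℤ x) :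
    R ≃ₗ[ℤ] integersIn R where
  toFun x := ⟨⟨x, hR x x.2⟩, x.2⟩
  map_add' _ _ := rfl
  map_smul' _ _ := Subtype.ext (RingOfIntegers.ext rfl)
  invFun x := ⟨x.1, x.2⟩
  left_inv _ := rfl
  right_inv _ := rfl

omit [NumberField F] in
theorem coe_integersInEquiv (R : Subalgebra ℤ F) (hR : ∀ x ∈ R, IsIntegral ℤ x) (x : R) :
    (((integersInEquiv R hR x : integersIn R) : 𝓞 F) : F) = x := rfl

/-- Comparison of the class number of an order with its index in the ring of integers. -/
theorem card_classGroup_order_bounds (R : Subalgebra ℤ F) (hR : ∀ x ∈ R, IsIntegral ℤ x)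
    (hm : orderIndex R ≠ 0) :
    (Nat.card (ClassGroup R) : ℝ) * ((unitsIn R F).relIndex (unitsIn (𝓞 F) F) : ℝ) ≤
        Nat.card (ClassGroup (𝓞 F)) *
          (orderIndex R * (((orderIndex R).primeFactors.card : ℝ) + 1) ^ Module.finrank ℚ F) ∧
      (orderIndex R : ℝ) ≤ (Nat.card (ClassGroup R) : ℝ) *
        ((unitsIn R F).relIndex (unitsIn (𝓞 F) F) : ℝ) *
          (((orderIndex R).primeFactors.card : ℝ) + 1) ^ Module.finrank ℚ F := by
  let i : R →+* 𝓞 F :=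
    { toFun := fun x => ⟨x, hR x x.2⟩
      map_one' := rfl
      map_mul' := fun _ _ => rfl
      map_zero' := rfl
      map_add' := fun _ _ => rfl }
  let : Algebra R (𝓞 F) := i.toAlgebra
  have : IsScalarTower R (𝓞 F) F := IsScalarTower.of_algebraMap_eq fun _ => rfl
  have hmem : ∀ x : 𝓞 F, ((orderIndex R • x : 𝓞 F) : F) ∈ R := fun x =>
    AddSubgroup.nsmul_index_mem (integersIn R).toAddSubgroup x
  have hfaith : FaithfulSMul R F := (faithfulSMul_iff_algebraMap_injective R F).2
    Subtype.val_injective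
  have hfrac : IsFractionRing R F := by
    refine IsFractionRing.of_field R F fun z => ?_
    obtain ⟨x, y, -, hz⟩ := IsFractionRing.div_surjective (A := 𝓞 F) z
    have hm' : (orderIndex R : F) ≠ 0 := Nat.cast_ne_zero.2 hm
    refine ⟨⟨_, hmem x⟩, ⟨_, hmem y⟩, ?_⟩
    show z = algebraMap (𝓞 F) F (orderIndex R • x) / algebraMap (𝓞 F) F (orderIndex R • y)
    rw [map_nsmul, map_nsmul, nsmul_eq_mul, nsmul_eq_mul, mul_div_mul_left _ _ hm', hz]
  have hrange : (algebraMap R (𝓞 F)).toAddMonoidHom.range = (integersIn R).toAddSubgroup := by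
    ext x
    exact ⟨by rintro ⟨y, rfl⟩; exact y.2, fun h => ⟨⟨x, h⟩, rfl⟩⟩
  have hfin : Finite (𝓞 F ⧸ integersIn R) := Nat.finite_of_card_ne_zero hm
  have hrank : Module.finrank ℤ (integersIn R) = Module.finrank ℚ F :=
    ((Submodule.finiteQuotient_iff _).1 hfin).trans (RingOfIntegers.rank F)
  have b : Module.Basis (Fin (Module.finrank ℚ F)) ℤ R :=
    ((Module.finBasis ℤ (integersIn R)).reindex (finCongr hrank)).map (integersInEquiv R hR).symm
  exact card_classGroup_mul_relIndex_bounds R rfl b (by rw [hrange]; rfl) hm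

theorem index_sq_mul_discr {d : ℕ} (hd : Module.finrank ℚ F = d) (M : Submodule ℤ (𝓞 F))
    (b : Module.Basis (Fin d) ℤ M) :
    (M.toAddSubgroup.index : ℚ) ^ 2 * discr F =
      Algebra.discr ℚ fun i => ((b i : 𝓞 F) : F) := by
  have hrank := RingOfIntegers.rank F
  rw [hd] at hrank
  let b₀ : Module.Basis (Fin d) ℤ (𝓞 F) := (Module.finBasis ℤ (𝓞 F)).reindex (finCongr hrank)
  have h1 : M.toAddSubgroup.index = (b₀.det ((↑) ∘ b)).natAbs :=
    (Submodule.natAbs_det_basis_change b₀ M b).symm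
  have h2 : Algebra.discr ℤ (fun i => (b i : 𝓞 F)) =
      (b₀.det ((↑) ∘ b)) ^ 2 * discr F := by
    rw [← NumberField.discr_eq_discr F b₀, Module.Basis.det_apply,
      ← Algebra.discr_of_matrix_vecMul, Module.Basis.toMatrix_map_vecMul]
    rfl
  have h3 : Algebra.discr ℚ (fun i => ((b i : 𝓞 F) : F)) =
      ((Algebra.discr ℤ (fun i => (b i : 𝓞 F)) : ℤ) : ℚ) := by
    rw [Algebra.discr_def, Algebra.discr_def, Int.cast_det]
    congr 1
    ext i j
    rw [Algebra.traceMatrix_apply, Matrix.map_apply, Algebra.traceMatrix_apply,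
      Algebra.traceForm_apply, Algebra.traceForm_apply, Algebra.coe_trace_int]
    rfl
  rw [h3, h2, h1]
  push_cast
  rw [Nat.cast_natAbs, Int.cast_abs, sq_abs]

/-- The index of `ℤ[β]` in terms of the differences of the conjugates of `β`. -/
theorem orderIndex_adjoin_sq {d : ℕ} (hd : Module.finrank ℚ F = d) {β : F} (hβ : IsIntegral ℤ β)
    (htop : ℚ⟮β⟯ = ⊤) (e : Fin d ≃ (F →ₐ[ℚ] ℂ)) :
    ((orderIndex (Algebra.adjoin ℤ {β}) : ℝ) ^ 2 * |(discr F : ℝ)| =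
      ∏ i, ∏ j ∈ Finset.Ioi i, ‖e j β - e i β‖ ^ 2) := by
  have hint : IsIntegral ℚ β := Algebra.IsIntegral.isIntegral β
  have htop' : Algebra.adjoin ℚ {β} = ⊤ := by
    rw [← IntermediateField.adjoin_simple_toSubalgebra_of_isAlgebraic hint.isAlgebraic, htop,
      IntermediateField.top_toSubalgebra]
  let pb := PowerBasis.ofAdjoinEqTop' hint htop'
  have hgen : pb.gen = β := PowerBasis.ofAdjoinEqTop'_gen hint htop'
  have hdim : pb.dim = d := by rw [← pb.finrank, hd]
  subst hdim
  have hR : ∀ x ∈ Algebra.adjoin ℤ {β}, IsIntegral ℤ x := fun x hx =>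
    adjoin_le_integralClosure hβ hx
  let pbZ := Algebra.adjoin.powerBasis' hβ
  have hgenZ : (pbZ.gen : F) = β := by rw [Algebra.adjoin.powerBasis'_gen]
  have hdimZ : pbZ.dim = pb.dim := by
    rw [Algebra.adjoin.powerBasis'_dim, PowerBasis.ofAdjoinEqTop'_dim,
      minpoly.isIntegrallyClosed_eq_field_fractions' ℚ hβ,
      (minpoly.monic hβ).natDegree_map]
  let b := (pbZ.basis.reindex (finCongr hdimZ)).map (integersInEquiv _ hR)
  have hb : (fun i => ((b i : 𝓞 F) : F)) = pb.basis := by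
    ext i
    rw [PowerBasis.coe_basis, hgen, Module.Basis.map_apply, coe_integersInEquiv,
      Module.Basis.reindex_apply, PowerBasis.coe_basis]
    simp [hgenZ]
  have h := index_sq_mul_discr hd _ b
  rw [hb] at h
  have h' := congrArg (algebraMap ℚ ℂ) h
  rw [Algebra.discr_powerBasis_eq_prod ℚ ℂ pb e, hgen] at h'
  have h'' := congrArg norm h'
  rw [norm_prod] at h''
  simp only [norm_prod, norm_pow] at h''
  rw [← h'']
  simp [orderIndex]

theorem orderIndex_adjoin_ne_zero {β : F} (hβ : IsIntegral ℤ β) (htop : ℚ⟮β⟯ = ⊤) :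
    orderIndex (Algebra.adjoin ℤ {β}) ≠ 0 := by
  intro h
  obtain ⟨e⟩ : Nonempty (Fin (Module.finrank ℚ F) ≃ (F →ₐ[ℚ] ℂ)) :=
    ⟨(Fintype.equivFinOfCardEq (AlgHom.card ℚ F ℂ)).symm⟩
  have h1 := orderIndex_adjoin_sq rfl hβ htop e
  rw [h, Nat.cast_zero, zero_pow two_ne_zero, zero_mul, eq_comm, Finset.prod_eq_zero_iff] at h1
  obtain ⟨i, -, h1⟩ := h1
  rw [Finset.prod_eq_zero_iff] at h1
  obtain ⟨j, hj, h1⟩ := h1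
  rw [pow_eq_zero_iff two_ne_zero, norm_eq_zero, sub_eq_zero] at h1
  have := (Field.primitive_element_iff_algHom_eq_of_eval' ℚ ℂ
    (fun x => IsAlgClosed.splits _) β).1 htop h1
  exact (Finset.mem_Ioi.1 hj).ne' (e.injective this)

end OrderIndex

/-! ### Orders in an extension of number fields -/

section Tower

open NumberField

variable (F : Type*) {K : Type*} [Field F] [NumberField F] [Field K] [NumberField K] [Algebra F K]

/-- The map `(x, y) ↦ x + γ y` on pairs of integers of a subfield. -/
noncomputable def pairHom (γ : 𝓞 K) : 𝓞 F × 𝓞 F →+ 𝓞 K where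
  toFun p := algebraMap (𝓞 F) (𝓞 K) p.1 + γ * algebraMap (𝓞 F) (𝓞 K) p.2
  map_zero' := by simp
  map_add' p r := by simp only [Prod.fst_add, Prod.snd_add, map_add]; ring

variable {F}

omit [NumberField F] [NumberField K] in
theorem pairHom_apply (γ : 𝓞 K) (p : 𝓞 F × 𝓞 F) :
    pairHom F γ p = algebraMap (𝓞 F) (𝓞 K) p.1 + γ * algebraMap (𝓞 F) (𝓞 K) p.2 := rfl

omit [NumberField F] [NumberField K] in
theorem coe_pairHom (γ : 𝓞 K) (p : 𝓞 F × 𝓞 F) :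
    (pairHom F γ p : K) = algebraMap F K p.1 + γ * algebraMap F K p.2 := rfl

theorem pairHom_injective {γ : 𝓞 K} (hγ : ∀ x : F, algebraMap F K x ≠ γ) :
    Function.Injective (pairHom F γ) := by
  rw [injective_iff_map_eq_zero]
  rintro ⟨x, y⟩ h
  have h' : algebraMap F K x + γ * algebraMap F K y = 0 := by
    rw [← coe_pairHom γ (x, y), h]
    exact map_zero (algebraMap (𝓞 K) K)
  have hy : y = 0 := by
    by_contra hy
    have hy' : algebraMap F K y ≠ 0 := by
      rw [Ne, map_eq_zero]
      exact RingOfIntegers.coe_ne_zero_iff.2 hy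
    refine hγ (-x / y) ?_
    rw [map_div₀, map_neg, div_eq_iff hy', neg_eq_iff_add_eq_zero]
    exact h'
  subst hy
  have h0 : ((0 : 𝓞 F) : F) = 0 := map_zero (algebraMap (𝓞 F) F)
  rw [h0, map_zero, mul_zero, add_zero, map_eq_zero] at h'
  exact Prod.ext (RingOfIntegers.coe_eq_zero_iff.1 h') rfl

theorem index_range_pairHom_ne_zero (hK : Module.finrank F K = 2) {γ : 𝓞 K}
    (hγ : ∀ x : F, algebraMap F K x ≠ γ) : (pairHom F γ).range.index ≠ 0 := by
  have h := LinearMap.finrank_range_of_inj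
    (f := (pairHom F γ).toIntLinearMap) (pairHom_injective hγ)
  have hrank : Module.finrank ℤ (pairHom F γ).toIntLinearMap.range = Module.finrank ℤ (𝓞 K) := by
    rw [h, Module.finrank_prod, RingOfIntegers.rank, RingOfIntegers.rank,
      ← Module.finrank_mul_finrank ℚ F K, hK, mul_two]
  have := Submodule.finiteQuotientOfFreeOfRankEq _ hrank
  exact Nat.card_pos (α := 𝓞 K ⧸ (pairHom F γ).toIntLinearMap.range).ne'

/-- If `γ = a + b α` then `𝓞 F + γ 𝓞 F` has index `|N b|` in `𝓞 F + α 𝓞 F`. -/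
theorem index_range_pairHom {α γ : 𝓞 K} (hα : ∀ x : F, algebraMap F K x ≠ α) {a b : 𝓞 F}
    (hγ : γ = algebraMap (𝓞 F) (𝓞 K) a + algebraMap (𝓞 F) (𝓞 K) b * α) :
    (pairHom F γ).range.index =
      Ideal.absNorm (Ideal.span {b}) * (pairHom F α).range.index := by
  have hle : (pairHom F γ).range =
      ((Ideal.span {b}).toAddSubgroup.comap (AddMonoidHom.snd (𝓞 F) (𝓞 F))).map (pairHom F α) := by
    ext z
    constructor
    · rintro ⟨⟨x, y⟩, rfl⟩
      refine ⟨(x + a * y, b * y), Ideal.mul_mem_right _ _ (Ideal.mem_span_singleton_self b), ?_⟩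
      simp only [pairHom_apply, hγ, map_add, map_mul]
      ring
    · rintro ⟨⟨u, v⟩, hv, rfl⟩
      obtain ⟨y, rfl⟩ := Ideal.mem_span_singleton'.1 (show v ∈ Ideal.span {b} from hv)
      refine ⟨(u - a * y, y), ?_⟩
      simp only [pairHom_apply, hγ, map_sub, map_mul]
      ring
  rw [hle, AddSubgroup.index_map_of_injective _ (pairHom_injective hα),
    AddSubgroup.index_comap_of_surjective _ Prod.snd_surjective]
  rfl

theorem orderIndex_of_pair {R : Subalgebra ℤ F} {R' : Subalgebra ℤ K}
    (hR : ∀ x ∈ R, IsIntegral ℤ x) {γ : 𝓞 K} (hγ : ∀ x : F, algebraMap F K x ≠ γ)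
    (hR' : ∀ z, z ∈ R' ↔ ∃ x ∈ R, ∃ y ∈ R, z = algebraMap F K x + γ * algebraMap F K y) :
    orderIndex R' = orderIndex R ^ 2 * (pairHom F γ).range.index := by
  have h : (integersIn R').toAddSubgroup =
      ((integersIn R).toAddSubgroup.prod (integersIn R).toAddSubgroup).map (pairHom F γ) := by
    ext z
    constructor
    · intro hz
      obtain ⟨x, hx, y, hy, hxy⟩ := (hR' z).1 hz
      refine ⟨(⟨x, hR x hx⟩, ⟨y, hR y hy⟩), ⟨hx, hy⟩, ?_⟩
      exact RingOfIntegers.ext hxy.symm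
    · rintro ⟨⟨x, y⟩, ⟨hx, hy⟩, rfl⟩
      exact (hR' _).2 ⟨x, hx, y, hy, rfl⟩
  rw [orderIndex, h, AddSubgroup.index_map_of_injective _ (pairHom_injective hγ),
    AddSubgroup.index_prod, sq]
  rfl

theorem absNorm_span_singleton_eq_prod (b : 𝓞 F) :
    (Ideal.absNorm (Ideal.span {b}) : ℝ) = ∏ ψ : F →ₐ[ℚ] ℂ, ‖ψ b‖ := by
  rw [Ideal.absNorm_span_singleton, Nat.cast_natAbs, ← norm_prod,
    ← Algebra.norm_eq_prod_embeddings ℚ ℂ, ← Algebra.coe_norm_int]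
  simp

end Tower

/-! ### The orders attached to a Weil number, and their units -/

section WeilOrders

open NumberField ComplexConjugate

variable {K : Type*} [Field K] [NumberField K] [IsCMField K] {q : ℕ} {α : K}

theorem IsWeilNumber.isIntegral_div (hα : IsWeilNumber q α) (hq : 0 < q) :
    IsIntegral ℤ ((q : K) / α) := by
  rw [← hα.complexConj_eq hq]
  exact hα.1.map (IsCMField.complexConj K).toRingHom.toIntAlgHom

theorem IsWeilNumber.complexConj_div (hα : IsWeilNumber q α) (hq : 0 < q) :
    IsCMField.complexConj K ((q : K) / α) = α := by
  rw [← hα.complexConj_eq hq, IsCMField.complexConj_apply_apply]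

theorem IsWeilNumber.exists_real_trace (hα : IsWeilNumber q α) (hq : 0 < q) (n : ℕ) :
    ∃ β : 𝓞 (maximalRealSubfield K), algebraMap (maximalRealSubfield K) K β =
      α ^ n + ((q : K) / α) ^ n := by
  have hint : IsIntegral ℤ (α ^ n + ((q : K) / α) ^ n) :=
    (hα.1.pow n).add ((hα.isIntegral_div hq).pow n)
  have hfix : IsCMField.complexConj K (α ^ n + ((q : K) / α) ^ n) =
      α ^ n + ((q : K) / α) ^ n := by
    rw [map_add, map_pow, map_pow, hα.complexConj_div hq, hα.complexConj_eq hq, add_comm]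
  have hmem : α ^ n + ((q : K) / α) ^ n ∈ maximalRealSubfield K :=
    (IsCMField.complexConj_eq_self_iff K _).1 hfix
  refine ⟨⟨⟨_, hmem⟩, ?_⟩, rfl⟩
  exact (isIntegral_algebraMap_iff (algebraMap (maximalRealSubfield K) K).injective).1 hint

/-- The powers of `α` in terms of `α`, over the integers of the real subfield. -/
theorem IsWeilNumber.exists_pow_eq (hα : IsWeilNumber q α) (hq : 0 < q) (n : ℕ) :
    ∃ a b : 𝓞 (maximalRealSubfield K), α ^ n =
      algebraMap (maximalRealSubfield K) K a + algebraMap (maximalRealSubfield K) K b * α := by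
  obtain ⟨β, hβ⟩ := hα.exists_real_trace hq 1
  have hα2 : α ^ 2 = algebraMap (maximalRealSubfield K) K β * α - q := by
    have h0 := hα.ne_zero hq
    rw [hβ]
    field_simp
    ring
  induction n with
  | zero => exact ⟨1, 0, by simp⟩
  | succ n ih =>
    obtain ⟨a, b, h⟩ := ih
    refine ⟨-(b * q), a + b * β, ?_⟩
    rw [pow_succ, h, add_mul, mul_assoc, ← sq, hα2]
    simp only [map_add, map_mul, map_neg, map_natCast]
    ring

omit [IsCMField K] in
theorem IsWeilNumber.mem_weilOrder_iff (hα : IsWeilNumber q α) (hq : 0 < q) {n : ℕ}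
    {β : maximalRealSubfield K}
    (hβ : algebraMap (maximalRealSubfield K) K β = α ^ n + ((q : K) / α) ^ n) (z : K) :
    z ∈ weilOrder q α n ↔ ∃ x ∈ Algebra.adjoin ℤ {β}, ∃ y ∈ Algebra.adjoin ℤ {β},
      z = algebraMap (maximalRealSubfield K) K x + α ^ n * algebraMap (maximalRealSubfield K) K y := by
  set i := algebraMap (maximalRealSubfield K) K
  set R := Algebra.adjoin ℤ {β}
  have h0 := hα.ne_zero hq
  have hprod : α ^ n * ((q : K) / α) ^ n = (q : K) ^ n := by
    rw [← mul_pow, mul_div_cancel₀ _ h0]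
  have hsq : α ^ n * α ^ n = i β * α ^ n - (q : K) ^ n := by
    rw [hβ, ← hprod]; ring
  have hβR : β ∈ R := Algebra.self_mem_adjoin_singleton ℤ β
  have hαmem : α ^ n ∈ weilOrder q α n := Algebra.subset_adjoin (by simp)
  have hαmem' : ((q : K) / α) ^ n ∈ weilOrder q α n := Algebra.subset_adjoin (by simp)
  constructor
  · intro hz
    induction hz using Algebra.adjoin_induction with
    | mem z hz =>
      rcases hz with rfl | rfl
      · exact ⟨0, zero_mem _, 1, one_mem _, by simp⟩
      · exact ⟨β, hβR, -1, neg_mem (one_mem _), by rw [hβ]; simp⟩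
    | algebraMap r => exact ⟨algebraMap ℤ _ r, R.algebraMap_mem r, 0, zero_mem _, by simp⟩
    | add z w _ _ hz hw =>
      obtain ⟨x, hx, y, hy, rfl⟩ := hz
      obtain ⟨x', hx', y', hy', rfl⟩ := hw
      exact ⟨x + x', add_mem hx hx', y + y', add_mem hy hy', by simp only [map_add]; ring⟩
    | mul z w _ _ hz hw =>
      obtain ⟨x, hx, y, hy, rfl⟩ := hz
      obtain ⟨x', hx', y', hy', rfl⟩ := hw
      refine ⟨x * x' - (q : maximalRealSubfield K) ^ n * (y * y'), ?_,
        x * y' + x' * y + β * (y * y'), ?_, ?_⟩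
      · exact sub_mem (mul_mem hx hx') (mul_mem (pow_mem (natCast_mem R q) n) (mul_mem hy hy'))
      · exact add_mem (add_mem (mul_mem hx hy') (mul_mem hx' hy)) (mul_mem hβR (mul_mem hy hy'))
      · simp only [map_add, map_sub, map_mul, map_pow, map_natCast]
        linear_combination (i y * i y') * hsq
  · rintro ⟨x, hx, y, hy, rfl⟩
    have key : ∀ x ∈ R, i x ∈ weilOrder q α n := by
      intro x hx
      induction hx using Algebra.adjoin_induction with
      | mem x hx =>
        rw [Set.mem_singleton_iff.1 hx, hβ]
        exact add_mem hαmem hαmem'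
      | algebraMap r =>
        rw [← IsScalarTower.algebraMap_apply]
        exact Subalgebra.algebraMap_mem _ r
      | add x y _ _ hx hy => rw [map_add]; exact add_mem hx hy
      | mul x y _ _ hx hy => rw [map_mul]; exact mul_mem hx hy
    exact add_mem (key x hx) (mul_mem hαmem (key y hy))

omit [NumberField K] [IsCMField K] in
theorem card_classGroup_realWeilOrder {n : ℕ} {β : maximalRealSubfield K}
    (hβ : algebraMap (maximalRealSubfield K) K β = α ^ n + ((q : K) / α) ^ n) :
    Nat.card (ClassGroup (realWeilOrder q α n)) =
      Nat.card (ClassGroup (Algebra.adjoin ℤ {β})) := by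
  let i : maximalRealSubfield K →ₐ[ℤ] K := (algebraMap (maximalRealSubfield K) K).toIntAlgHom
  have hmap : (Algebra.adjoin ℤ {β}).map i = realWeilOrder q α n := by
    rw [AlgHom.map_adjoin_singleton]
    exact congrArg (fun x => Algebra.adjoin ℤ {x}) hβ
  let e : Algebra.adjoin ℤ {β} ≃ₐ[ℤ] realWeilOrder q α n :=
    ((Algebra.adjoin ℤ {β}).equivMapOfInjective i
      (algebraMap (maximalRealSubfield K) K).injective).trans (Subalgebra.equivOfEq _ _ hmap)
  exact (Nat.card_congr (ClassGroup.mulEquiv e.toRingEquiv).toEquiv).symm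

theorem algebraMap_ne_pow {n : ℕ} (htop : ℚ⟮α ^ n⟯ = ⊤) (x : maximalRealSubfield K) :
    algebraMap (maximalRealSubfield K) K x ≠ α ^ n := by
  intro h
  obtain ⟨φ⟩ : Nonempty (K →+* ℂ) := inferInstance
  refine IsTotallyComplex.complexEmbedding_not_isReal φ (ext_of_adjoin_simple_eq_top htop ?_)
  have h1 := IsCMField.complexConj_apply_eq_self K x
  have h2 : IsCMField.complexConj K (α ^ n) = α ^ n := by rw [← h]; exact h1
  have h3 := IsCMField.complexEmbedding_complexConj K φ (α ^ n)
  rw [h2] at h3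
  exact h3.symm

theorem IsWeilNumber.adjoin_real_trace_eq_top (hα : IsWeilNumber q α) (hq : 0 < q) {n : ℕ}
    (htop : ℚ⟮α ^ n⟯ = ⊤) {β : maximalRealSubfield K}
    (hβ : algebraMap (maximalRealSubfield K) K β = α ^ n + ((q : K) / α) ^ n) : ℚ⟮β⟯ = ⊤ := by
  rw [Field.primitive_element_iff_algHom_eq_of_eval' ℚ ℂ (fun x => IsAlgClosed.splits _)]
  intro ψ₁ ψ₂ h
  have h0 := hα.ne_zero hq
  set φ₁ := ComplexEmbedding.lift K (ψ₁ : maximalRealSubfield K →+* ℂ)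
  set φ₂ := ComplexEmbedding.lift K (ψ₂ : maximalRealSubfield K →+* ℂ)
  have e₁ : ∀ x, φ₁ (algebraMap _ K x) = ψ₁ x := fun x =>
    ComplexEmbedding.lift_algebraMap_apply K (ψ₁ : maximalRealSubfield K →+* ℂ) x
  have e₂ : ∀ x, φ₂ (algebraMap _ K x) = ψ₂ x := fun x =>
    ComplexEmbedding.lift_algebraMap_apply K (ψ₂ : maximalRealSubfield K →+* ℂ) x
  have hconj : ∀ x : maximalRealSubfield K, conj (φ₂ (algebraMap _ K x)) = φ₂ (algebraMap _ K x) := by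
    intro x
    rw [← IsCMField.complexEmbedding_complexConj]
    exact congrArg φ₂ (IsCMField.complexConj_apply_eq_self K x)
  have hprod : ∀ φ : K →+* ℂ, φ (α ^ n) * φ (((q : K) / α) ^ n) = (q : ℂ) ^ n := fun φ => by
    rw [← map_mul, ← mul_pow, mul_div_cancel₀ _ h0, map_pow, map_natCast]
  have h1 : φ₁ (α ^ n) + φ₁ (((q : K) / α) ^ n) = φ₂ (α ^ n) + φ₂ (((q : K) / α) ^ n) := by
    rw [← map_add, ← map_add, ← hβ, e₁, e₂]
    exact h
  have h2 : (φ₁ (α ^ n) - φ₂ (α ^ n)) * (φ₁ (α ^ n) - φ₂ (((q : K) / α) ^ n)) = 0 := by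
    linear_combination φ₁ (α ^ n) * h1 - hprod φ₁ + hprod φ₂
  have h3 : φ₁ = φ₂ ∨ φ₁ = ComplexEmbedding.conjugate φ₂ := by
    rcases mul_eq_zero.1 h2 with h | h
    · exact Or.inl (ext_of_adjoin_simple_eq_top htop (sub_eq_zero.1 h))
    · refine Or.inr (ext_of_adjoin_simple_eq_top htop ?_)
      rw [sub_eq_zero.1 h, ComplexEmbedding.conjugate_coe_eq, map_pow, map_pow, map_pow,
        hα.conj_apply hq]
  ext x
  rcases h3 with h | h
  · rw [← e₁, ← e₂, h]
  · rw [← e₁, ← e₂, h, ComplexEmbedding.conjugate_coe_eq, hconj]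

end WeilOrders

section UnitIndex

open NumberField

theorem mem_unitsIn_subalgebra {F : Type*} [Field F] {R : Subalgebra ℤ F} {x : Fˣ} :
    x ∈ unitsIn R F ↔ (x : F) ∈ R ∧ ((x⁻¹ : Fˣ) : F) ∈ R := by
  have : FaithfulSMul R F := (faithfulSMul_iff_algebraMap_injective R F).2 Subtype.val_injective
  rw [mem_unitsIn_iff, Submodule.mem_one, Submodule.mem_one]
  exact ⟨fun ⟨⟨a, ha⟩, ⟨b, hb⟩⟩ => ⟨ha ▸ a.2, hb ▸ b.2⟩, fun ⟨ha, hb⟩ => ⟨⟨⟨_, ha⟩, rfl⟩, ⟨⟨_, hb⟩, rfl⟩⟩⟩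

theorem mem_unitsIn_ringOfIntegers {F : Type*} [Field F] [NumberField F] {x : Fˣ} :
    x ∈ unitsIn (𝓞 F) F ↔ IsIntegral ℤ (x : F) ∧ IsIntegral ℤ ((x⁻¹ : Fˣ) : F) := by
  rw [mem_unitsIn_iff, Submodule.mem_one, Submodule.mem_one]
  exact ⟨fun ⟨⟨a, ha⟩, ⟨b, hb⟩⟩ => ⟨ha ▸ a.2, hb ▸ b.2⟩, fun ⟨ha, hb⟩ => ⟨⟨⟨_, ha⟩, rfl⟩, ⟨⟨_, hb⟩, rfl⟩⟩⟩

variable (K : Type*) [Field K] [NumberField K] [IsCMField K]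

/-- The units of the real subfield have finite index in the units of a CM field. -/
theorem relIndex_map_unitsIn_ne_zero :
    ((unitsIn (𝓞 (maximalRealSubfield K)) (maximalRealSubfield K)).map
      (Units.map (algebraMap (maximalRealSubfield K) K : maximalRealSubfield K →* K))).relIndex
        (unitsIn (𝓞 K) K) ≠ 0 := by
  set j : (𝓞 K)ˣ →* Kˣ := Units.map (algebraMap (𝓞 K) K : 𝓞 K →* K)
  have hj : Function.Injective j := Units.map_injective RingOfIntegers.coe_injective
  have h1 : (unitsIn (𝓞 (maximalRealSubfield K)) (maximalRealSubfield K)).map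
      (Units.map (algebraMap (maximalRealSubfield K) K : maximalRealSubfield K →* K)) =
      (IsCMField.realUnits K).map j := by
    rw [IsCMField.realUnits, unitsIn, MonoidHom.map_range, MonoidHom.map_range]
    rfl
  have h2 : unitsIn (𝓞 K) K = (⊤ : Subgroup (𝓞 K)ˣ).map j := MonoidHom.range_eq_map _
  rw [h1, h2, Subgroup.relIndex_map_map_of_injective _ _ hj, Subgroup.relIndex_top_right,
    ← IsCMField.unitsMulComplexConjInv_ker, Subgroup.index_ker]
  exact Nat.card_pos.ne'

variable {K}

/-- The unit indices of two orders `R ⊆ 𝓞 K⁺` and `R' ⊆ 𝓞 K` with `R' ∩ K⁺ = R` agree up to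
a bounded factor. -/
theorem relIndex_unitsIn_bounds {R : Subalgebra ℤ (maximalRealSubfield K)} {R' : Subalgebra ℤ K}
    (hR : ∀ x ∈ R, IsIntegral ℤ x)
    (h : ∀ x : maximalRealSubfield K, algebraMap (maximalRealSubfield K) K x ∈ R' ↔ x ∈ R)
    (h1 : (unitsIn R (maximalRealSubfield K)).relIndex
      (unitsIn (𝓞 (maximalRealSubfield K)) (maximalRealSubfield K)) ≠ 0)
    (h2 : (unitsIn R' K).relIndex (unitsIn (𝓞 K) K) ≠ 0) :
    (unitsIn R (maximalRealSubfield K)).relIndex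
        (unitsIn (𝓞 (maximalRealSubfield K)) (maximalRealSubfield K)) ≤
      (unitsIn R' K).relIndex (unitsIn (𝓞 K) K) ∧
    (unitsIn R' K).relIndex (unitsIn (𝓞 K) K) ≤
      (unitsIn R (maximalRealSubfield K)).relIndex
        (unitsIn (𝓞 (maximalRealSubfield K)) (maximalRealSubfield K)) *
      ((unitsIn (𝓞 (maximalRealSubfield K)) (maximalRealSubfield K)).map
        (Units.map (algebraMap (maximalRealSubfield K) K : maximalRealSubfield K →* K))).relIndex
          (unitsIn (𝓞 K) K) := by
  set i : (maximalRealSubfield K)ˣ →* Kˣ :=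
    Units.map (algebraMap (maximalRealSubfield K) K : maximalRealSubfield K →* K)
  have hi : Function.Injective i := Units.map_injective (algebraMap (maximalRealSubfield K) K).injective
  set U := unitsIn (𝓞 K) K
  set V := unitsIn R' K
  set Up := unitsIn (𝓞 (maximalRealSubfield K)) (maximalRealSubfield K)
  set Vp := unitsIn R (maximalRealSubfield K)
  have hinf : Vp.map i = V ⊓ Up.map i := by
    ext x
    constructor
    · rintro ⟨u, hu, rfl⟩
      obtain ⟨hu1, hu2⟩ := mem_unitsIn_subalgebra.1 hu
      exact ⟨mem_unitsIn_subalgebra.2 ⟨(h _).2 hu1, (by rw [← map_inv]; exact (h _).2 hu2)⟩,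
        u, mem_unitsIn_ringOfIntegers.2 ⟨hR _ hu1, hR _ hu2⟩, rfl⟩
    · rintro ⟨hx, u, -, rfl⟩
      obtain ⟨hx1, hx2⟩ := mem_unitsIn_subalgebra.1 hx
      rw [← map_inv] at hx2
      exact ⟨u, mem_unitsIn_subalgebra.2 ⟨(h _).1 hx1, (h _).1 hx2⟩, rfl⟩
  have hUp : Up.map i ≤ U := by
    rintro _ ⟨u, hu, rfl⟩
    obtain ⟨hu1, hu2⟩ := mem_unitsIn_ringOfIntegers.1 hu
    refine mem_unitsIn_ringOfIntegers.2 ⟨?_, ?_⟩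
    · exact hu1.algebraMap
    · rw [← map_inv]; exact hu2.algebraMap
  have e1 : Vp.relIndex Up = V.relIndex (Up.map i) := by
    rw [← Subgroup.relIndex_map_map_of_injective _ _ hi, hinf, Subgroup.inf_relIndex_right]
  refine ⟨?_, ?_⟩
  · rw [e1]
    exact Subgroup.relIndex_le_of_le_right hUp h2
  · have e2 : V.relIndex U ∣ (V ⊓ Up.map i).relIndex U := Subgroup.relIndex_dvd_of_le_left _ inf_le_left
    rw [← Subgroup.relIndex_mul_relIndex _ _ _ inf_le_right hUp, Subgroup.inf_relIndex_right,
      ← e1] at e2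
    exact Nat.le_of_dvd (Nat.pos_of_ne_zero (mul_ne_zero h1 (relIndex_map_unitsIn_ne_zero K))) e2

end UnitIndex

/-! ### A set of exponents of density one -/

section Density

open Finset in
theorem card_le_of_spaced {M N : ℕ} (hM : 0 < M) (A : Finset ℕ) (hA : ∀ n ∈ A, n ≤ N)
    (h : ∀ n ∈ A, ∀ m ∈ A, n < m → M ≤ m - n) : A.card ≤ N / M + 1 := by
  rw [← card_range (N / M + 1)]
  refine card_le_card_of_injOn (fun n => n / M) ?_ ?_
  · intro n hn
    simp only [coe_range, Set.mem_Iio]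
    exact Nat.lt_succ_of_le (Nat.div_le_div_right (hA n hn))
  · intro n hn m hm hnm
    have key : ∀ n ∈ A, ∀ m ∈ A, n / M = m / M → ¬ n < m := by
      intro n hn m hm hnm hlt
      have h1 := h n hn m hm hlt
      have h2 := Nat.div_add_mod n M
      have h3 := Nat.div_add_mod m M
      have h4 := Nat.mod_lt m hM
      rw [hnm] at h2
      omega
    exact le_antisymm (not_lt.1 (key m hm n hn hnm.symm)) (not_lt.1 (key n hn m hm hnm))

/-- Integers `n` for which `u ^ n` is close to `1` are widely spaced, because the difference of two
of them has the same property. -/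
theorem tendsto_card_pow_near_one {u : ℂ} (hu : ‖u‖ = 1) (hroot : ∀ m : ℕ, 1 ≤ m → u ^ m ≠ 1) :
    Tendsto (fun N : ℕ => (((Finset.Icc 1 N).filter fun n : ℕ => ‖u ^ n - 1‖ < (n : ℝ)⁻¹).card : ℝ) /
      N) atTop (𝓝 0) := by
  rw [Metric.tendsto_atTop]
  intro η hη
  obtain ⟨M, hM⟩ := exists_nat_gt (2 / η)
  have hM0 : (0 : ℝ) < M := (by positivity : (0 : ℝ) < 2 / η).trans hM
  have hM0' : 0 < M := by exact_mod_cast hM0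
  obtain ⟨δ, hδ, hδM⟩ : ∃ δ : ℝ, 0 < δ ∧ ∀ m ∈ Finset.Icc 1 M, 2 * δ ≤ ‖u ^ m - 1‖ := by
    have hne : (Finset.Icc 1 M).Nonempty := ⟨1, Finset.mem_Icc.2 ⟨le_rfl, hM0'⟩⟩
    obtain ⟨m₀, hm₀, hmin⟩ := Finset.exists_min_image (Finset.Icc 1 M) (fun m => ‖u ^ m - 1‖) hne
    refine ⟨‖u ^ m₀ - 1‖ / 2, half_pos (norm_pos_iff.2 (sub_ne_zero.2
      (hroot m₀ (Finset.mem_Icc.1 hm₀).1))), fun m hm => ?_⟩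
    rw [mul_div_cancel₀ _ two_ne_zero]
    exact hmin m hm
  obtain ⟨n₀, hn₀⟩ := exists_nat_gt δ⁻¹
  have hcard : ∀ N : ℕ, (((Finset.Icc 1 N).filter fun n : ℕ => ‖u ^ n - 1‖ < (n : ℝ)⁻¹).card : ℝ) ≤
      n₀ + (N / M + 1) := by
    intro N
    set B := (Finset.Icc 1 N).filter fun n : ℕ => ‖u ^ n - 1‖ < (n : ℝ)⁻¹
    have h1 : B ⊆ Finset.range n₀ ∪ B.filter fun n => n₀ ≤ n := by
      intro n hn
      rw [Finset.mem_union, Finset.mem_range, Finset.mem_filter]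
      rcases lt_or_ge n n₀ with h | h
      · exact Or.inl h
      · exact Or.inr ⟨hn, h⟩
    have hδB : ∀ n ∈ B.filter fun n => n₀ ≤ n, ‖u ^ n - 1‖ < δ := by
      intro n hn
      obtain ⟨hnB, hn0⟩ := Finset.mem_filter.1 hn
      refine (Finset.mem_filter.1 hnB).2.trans_le ?_
      have : δ⁻¹ ≤ n := hn₀.le.trans (by exact_mod_cast hn0)
      exact inv_le_of_inv_le₀ hδ this
    have h2 : (B.filter fun n => n₀ ≤ n).card ≤ N / M + 1 := by
      refine card_le_of_spaced hM0' _ (fun n hn =>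
        (Finset.mem_Icc.1 (Finset.mem_filter.1 (Finset.mem_filter.1 hn).1).1).2) ?_
      intro n hn m hm hlt
      by_contra hlt'
      have h3 := hδM (m - n) (Finset.mem_Icc.2 ⟨by omega, by omega⟩)
      have h4 : ‖u ^ (m - n) - 1‖ = ‖(u ^ m - 1) - (u ^ n - 1)‖ := by
        have : (u ^ m - 1) - (u ^ n - 1) = u ^ n * (u ^ (m - n) - 1) := by
          rw [mul_sub, ← pow_add, Nat.add_sub_cancel' hlt.le]; ring
        rw [this, norm_mul, norm_pow, hu, one_pow, one_mul]
      have h5 := norm_sub_le (u ^ m - 1) (u ^ n - 1)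
      have h6 := hδB n hn
      have h7 := hδB m hm
      linarith
    have h3 : B.card ≤ n₀ + (N / M + 1) := by
      refine (Finset.card_le_card h1).trans ((Finset.card_union_le _ _).trans ?_)
      rw [Finset.card_range]
      exact Nat.add_le_add_left h2 _
    calc (B.card : ℝ) ≤ ((n₀ + (N / M + 1) : ℕ) : ℝ) := by exact_mod_cast h3
      _ ≤ n₀ + (N / M + 1) := by
        push_cast
        gcongr
        exact Nat.cast_div_le
  obtain ⟨N₀, hN₀⟩ := exists_nat_gt ((n₀ + 1) * 2 / η)
  refine ⟨N₀, fun N hN => ?_⟩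
  have hNpos : (0 : ℝ) < N := by
    have h1 : (0 : ℝ) < (n₀ + 1) * 2 / η := by positivity
    have h2 : (N₀ : ℝ) ≤ N := by exact_mod_cast hN
    linarith
  rw [Real.dist_eq, sub_zero, abs_of_nonneg (by positivity), div_lt_iff₀ hNpos]
  refine (hcard N).trans_lt ?_
  have h1 : (N : ℝ) / M ≤ η / 2 * N := by
    rw [div_le_iff₀ hM0]
    have : 1 ≤ η / 2 * M := by
      rw [div_lt_iff₀ hη] at hM
      linarith
    nlinarith
  have h2 : (n₀ : ℝ) + 1 < η / 2 * N := by
    have h3 : (n₀ + 1) * 2 / η < (N : ℝ) := hN₀.trans_le (by exact_mod_cast hN)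
    rw [div_lt_iff₀ hη] at h3
    linarith
  linarith

theorem hasNaturalDensity_pow_far_from_one {ι : Type*} [Finite ι] (u : ι → ℂ)
    (hu : ∀ i, ‖u i‖ = 1) (hroot : ∀ i, ∀ m : ℕ, 1 ≤ m → u i ^ m ≠ 1) :
    HasNaturalDensity {n : ℕ | ∀ i, (n : ℝ)⁻¹ ≤ ‖u i ^ n - 1‖} 1 := by
  classical
  have := Fintype.ofFinite ι
  set S : Set ℕ := {n : ℕ | ∀ i, (n : ℝ)⁻¹ ≤ ‖u i ^ n - 1‖}
  let B : ι → ℕ → Finset ℕ := fun i N =>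
    (Finset.Icc 1 N).filter fun n : ℕ => ‖u i ^ n - 1‖ < (n : ℝ)⁻¹
  have hsum : Tendsto (fun N : ℕ => ∑ i, ((B i N).card : ℝ) / N) atTop (𝓝 0) := by
    simpa using tendsto_finsetSum (Finset.univ : Finset ι)
      fun i _ => tendsto_card_pow_near_one (hu i) (hroot i)
  have hlow : Tendsto (fun N : ℕ => 1 - ∑ i, ((B i N).card : ℝ) / N) atTop (𝓝 1) := by
    simpa using hsum.const_sub 1
  refine tendsto_of_tendsto_of_tendsto_of_le_of_le' hlow tendsto_const_nhds ?_ ?_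
  · filter_upwards [eventually_gt_atTop 0] with N hN
    have hN' : (0 : ℝ) < N := by exact_mod_cast hN
    have hcover : (Set.Icc 1 N : Set ℕ) ⊆ (S ∩ Set.Icc 1 N) ∪
        ((Finset.univ.biUnion fun i => B i N : Finset ℕ) : Set ℕ) := by
      intro n hn
      by_cases hS : n ∈ S
      · exact Or.inl ⟨hS, hn⟩
      · right
        simp only [S, Set.mem_ofPred_eq, not_forall, not_le] at hS
        obtain ⟨i, hi⟩ := hS
        exact Finset.mem_coe.2 (Finset.mem_biUnion.2 ⟨i, Finset.mem_univ _,
          Finset.mem_filter.2 ⟨Finset.mem_Icc.2 hn, hi⟩⟩)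
    have hfin : ((S ∩ Set.Icc 1 N) ∪
        ((Finset.univ.biUnion fun i => B i N : Finset ℕ) : Set ℕ)).Finite :=
      ((Set.finite_Icc 1 N).subset Set.inter_subset_right).union (Finset.finite_toSet _)
    have h1 := (Set.ncard_le_ncard hcover hfin).trans (Set.ncard_union_le _ _)
    rw [Set.ncard_coe_finset, ← Finset.coe_Icc, Set.ncard_coe_finset, Nat.card_Icc,
      Nat.add_sub_cancel] at h1
    have h2 : N ≤ (S ∩ (Finset.Icc 1 N : Finset ℕ)).ncard + ∑ i, (B i N).card :=
      h1.trans (Nat.add_le_add_left Finset.card_biUnion_le _)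
    rw [Finset.coe_Icc] at h2
    have h3 : (N : ℝ) ≤ ((S ∩ Set.Icc 1 N).ncard : ℝ) + ∑ i, ((B i N).card : ℝ) := by
      exact_mod_cast h2
    rw [← Finset.sum_div, le_div_iff₀ hN', sub_mul, one_mul, div_mul_cancel₀ _ hN'.ne']
    linarith
  · filter_upwards [eventually_gt_atTop 0] with N hN
    have hN' : (0 : ℝ) < N := by exact_mod_cast hN
    rw [div_le_one hN']
    have h1 := Set.ncard_le_ncard (Set.inter_subset_right : S ∩ Set.Icc 1 N ⊆ Set.Icc 1 N)
      (Set.finite_Icc 1 N)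
    rw [← Finset.coe_Icc, Set.ncard_coe_finset, Nat.card_Icc, Nat.add_sub_cancel,
      Finset.coe_Icc] at h1
    exact_mod_cast h1

end Density

/-! ### Comparison up to polynomial factors -/

section PolyComparable

/-- On the set `S`, the sequences `f` and `g` are positive and bounded by each other up to a
polynomial factor. -/
def PolyComparable (S : Set ℕ) (f g : ℕ → ℝ) : Prop :=
  ∃ (A : ℕ) (B : ℝ), 1 ≤ B ∧ ∀ n ∈ S, 1 ≤ n → 0 < f n ∧ 0 < g n ∧
    f n ≤ B * (n : ℝ) ^ A * g n ∧ g n ≤ B * (n : ℝ) ^ A * f n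

variable {S : Set ℕ} {f g h f' g' : ℕ → ℝ}

theorem PolyComparable.symm (H : PolyComparable S f g) : PolyComparable S g f := by
  obtain ⟨A, B, hB, H⟩ := H
  exact ⟨A, B, hB, fun n hn h1 => ⟨(H n hn h1).2.1, (H n hn h1).1, (H n hn h1).2.2.2,
    (H n hn h1).2.2.1⟩⟩

theorem PolyComparable.mul (H : PolyComparable S f g) (H' : PolyComparable S f' g') :
    PolyComparable S (fun n => f n * f' n) (fun n => g n * g' n) := by
  obtain ⟨A, B, hB, H⟩ := H
  obtain ⟨A', B', hB', H'⟩ := H'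
  refine ⟨A + A', B * B', one_le_mul_of_one_le_of_one_le hB hB', fun n hn h1 => ?_⟩
  obtain ⟨a1, a2, a3, a4⟩ := H n hn h1
  obtain ⟨b1, b2, b3, b4⟩ := H' n hn h1
  refine ⟨mul_pos a1 b1, mul_pos a2 b2, ?_, ?_⟩
  · calc f n * f' n ≤ (B * (n : ℝ) ^ A * g n) * (B' * (n : ℝ) ^ A' * g' n) :=
        mul_le_mul a3 b3 b1.le (a1.le.trans a3)
      _ = _ := by ring
  · calc g n * g' n ≤ (B * (n : ℝ) ^ A * f n) * (B' * (n : ℝ) ^ A' * f' n) :=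
        mul_le_mul a4 b4 b2.le (a2.le.trans a4)
      _ = _ := by ring

theorem PolyComparable.trans (H : PolyComparable S f g) (H' : PolyComparable S g h) :
    PolyComparable S f h := by
  obtain ⟨A, B, hB, H⟩ := H
  obtain ⟨A', B', hB', H'⟩ := H'
  refine ⟨A + A', B * B', one_le_mul_of_one_le_of_one_le hB hB', fun n hn h1 => ?_⟩
  obtain ⟨a1, a2, a3, a4⟩ := H n hn h1
  obtain ⟨b1, b2, b3, b4⟩ := H' n hn h1
  refine ⟨a1, b2, ?_, ?_⟩
  · calc f n ≤ B * (n : ℝ) ^ A * g n := a3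
      _ ≤ B * (n : ℝ) ^ A * (B' * (n : ℝ) ^ A' * h n) := by gcongr
      _ = _ := by ring
  · calc h n ≤ B' * (n : ℝ) ^ A' * g n := b4
      _ ≤ B' * (n : ℝ) ^ A' * (B * (n : ℝ) ^ A * f n) := by gcongr
      _ = _ := by ring

theorem PolyComparable.inv (H : PolyComparable S f g) :
    PolyComparable S (fun n => (f n)⁻¹) (fun n => (g n)⁻¹) := by
  obtain ⟨A, B, hB, H⟩ := H
  refine ⟨A, B, hB, fun n hn h1 => ?_⟩
  obtain ⟨a1, a2, a3, a4⟩ := H n hn h1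
  refine ⟨inv_pos.2 a1, inv_pos.2 a2, ?_, ?_⟩
  · rw [inv_le_iff_one_le_mul₀ a1, mul_right_comm, ← div_eq_mul_inv, le_div_iff₀ a2, one_mul]
    exact a4
  · rw [inv_le_iff_one_le_mul₀ a2, mul_right_comm, ← div_eq_mul_inv, le_div_iff₀ a1, one_mul]
    exact a3

/-- A polynomial comparison from two inequalities with their own constants. -/
theorem PolyComparable.of_le {A A' : ℕ} {B B' : ℝ} (hf : ∀ n ∈ S, 1 ≤ n → 0 < f n)
    (hg : ∀ n ∈ S, 1 ≤ n → 0 < g n)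
    (h1 : ∀ n ∈ S, 1 ≤ n → f n ≤ B * (n : ℝ) ^ A * g n)
    (h2 : ∀ n ∈ S, 1 ≤ n → g n ≤ B' * (n : ℝ) ^ A' * f n) : PolyComparable S f g := by
  refine ⟨max A A', max 1 (max B B'), le_max_left _ _, fun n hn hn1 => ?_⟩
  have hn1' : (1 : ℝ) ≤ n := by exact_mod_cast hn1
  refine ⟨hf n hn hn1, hg n hn hn1, (h1 n hn hn1).trans ?_, (h2 n hn hn1).trans ?_⟩
  · have := (hg n hn hn1).le
    gcongr
    · exact (le_max_left _ _).trans (le_max_right _ _)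
    · exact le_max_left _ _
  · have := (hf n hn hn1).le
    gcongr
    · exact (le_max_right _ _).trans (le_max_right _ _)
    · exact le_max_right _ _

theorem PolyComparable.const_mul {c : ℝ} (hc : 0 < c) (hf : ∀ n ∈ S, 1 ≤ n → 0 < f n) :
    PolyComparable S (fun n => c * f n) f := by
  refine PolyComparable.of_le (A := 0) (A' := 0) (B := c) (B' := c⁻¹)
    (fun n hn h1 => mul_pos hc (hf n hn h1)) hf (fun n _ _ => by simp) fun n hn h1 => ?_
  rw [pow_zero, mul_one, inv_mul_cancel_left₀ hc.ne']

theorem PolyComparable.refl (hf : ∀ n ∈ S, 1 ≤ n → 0 < f n) : PolyComparable S f f :=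
  PolyComparable.of_le (A := 0) (A' := 0) (B := 1) (B' := 1) hf hf (fun n _ _ => by simp)
    fun n _ _ => by simp

theorem PolyComparable.congr (H : PolyComparable S f g) (hf : ∀ n ∈ S, 1 ≤ n → f n = f' n)
    (hg : ∀ n ∈ S, 1 ≤ n → g n = g' n) : PolyComparable S f' g' := by
  obtain ⟨A, B, hB, H⟩ := H
  refine ⟨A, B, hB, fun n hn h1 => ?_⟩
  rw [← hf n hn h1, ← hg n hn h1]
  exact H n hn h1

theorem PolyComparable.prod {ι : Type*} (s : Finset ι) {f g : ι → ℕ → ℝ}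
    (H : ∀ i ∈ s, PolyComparable S (f i) (g i)) :
    PolyComparable S (fun n => ∏ i ∈ s, f i n) fun n => ∏ i ∈ s, g i n := by
  classical
  induction s using Finset.induction_on with
  | empty => exact PolyComparable.refl fun _ _ _ => one_pos
  | insert i s hi ih =>
    simp only [Finset.prod_insert hi]
    exact (H i (Finset.mem_insert_self _ _)).mul
      (ih fun j hj => H j (Finset.mem_insert_of_mem hj))

theorem PolyComparable.mul_cancel_right (H : PolyComparable S (fun n => f n * h n) fun n => g n * h n)
    (hh : ∀ n ∈ S, 1 ≤ n → 0 < h n) : PolyComparable S f g :=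
  (H.mul (PolyComparable.refl hh).inv).congr
    (fun n hn h1 => mul_inv_cancel_right₀ (hh n hn h1).ne' _)
    fun n hn h1 => mul_inv_cancel_right₀ (hh n hn h1).ne' _

/-- A number has few prime divisors: if `m n` grows like an exponential, then the number of prime
divisors of `m n` is bounded by a polynomial in `n`. -/
theorem PolyComparable.card_primeFactors {m : ℕ → ℕ} {T : ℝ} (hT : 1 < T) {k : ℕ}
    (H : PolyComparable S (fun n => (m n : ℝ)) fun n => (T ^ n) ^ k) (d : ℕ) :
    PolyComparable S (fun n => (((m n).primeFactors.card : ℝ) + 1) ^ d) fun _ => 1 := by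
  obtain ⟨A, B, hB, H⟩ := H
  beta_reduce at H
  set C : ℝ := (Real.log B + A + k * Real.log T) / Real.log 2
  have hlog2 : 0 < Real.log 2 := Real.log_pos one_lt_two
  have hlogB : 0 ≤ Real.log B := Real.log_nonneg hB
  have hlogT : 0 ≤ Real.log T := Real.log_nonneg hT.le
  have hC : ∀ n ∈ S, 1 ≤ n → ((m n).primeFactors.card : ℝ) ≤ C * n := by
    intro n hn h1
    obtain ⟨a1, -, a3, -⟩ := H n hn h1
    have hn' : (1 : ℝ) ≤ n := by exact_mod_cast h1
    have hm : 2 ^ (m n).primeFactors.card ≤ m n := by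
      have h2 : 2 ^ (m n).primeFactors.card ≤ ∏ p ∈ (m n).primeFactors, p :=
        Finset.pow_card_le_prod _ _ _ fun p hp => (Nat.mem_primeFactors.1 hp).1.two_le
      have h3 : 0 < m n := by exact_mod_cast a1
      exact h2.trans (Nat.le_of_dvd h3 (Nat.prod_primeFactors_dvd (m n)))
    have hm' : (2 : ℝ) ^ (m n).primeFactors.card ≤ B * (n : ℝ) ^ A * (T ^ n) ^ k :=
      le_trans (by exact_mod_cast hm) a3
    have hlog := Real.log_le_log (by positivity) hm'
    rw [Real.log_pow, Real.log_mul (by positivity) (by positivity),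
      Real.log_mul (by positivity) (by positivity), Real.log_pow, Real.log_pow, Real.log_pow] at hlog
    have hlogn : Real.log n ≤ n := (Real.log_le_sub_one_of_pos (by linarith)).trans (by linarith)
    rw [div_mul_eq_mul_div, le_div_iff₀ hlog2]
    calc ((m n).primeFactors.card : ℝ) * Real.log 2
        ≤ Real.log B + A * Real.log n + k * (n * Real.log T) := hlog
      _ ≤ Real.log B * n + A * n + k * (n * Real.log T) := by
          gcongr
          exact le_mul_of_one_le_right hlogB hn'
      _ = (Real.log B + A + k * Real.log T) * n := by ring
  refine PolyComparable.of_le (A := d) (B := (C + 1) ^ d) (A' := 0) (B' := 1)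
    (fun n _ _ => by positivity) (fun _ _ _ => one_pos) ?_ ?_
  · intro n hn h1
    have hn' : (1 : ℝ) ≤ n := by exact_mod_cast h1
    rw [mul_one, ← mul_pow]
    gcongr
    have := hC n hn h1
    nlinarith
  · intro n _ _
    rw [pow_zero, one_mul, one_mul]
    exact one_le_pow₀ (by linarith [Nat.cast_nonneg (α := ℝ) (m n).primeFactors.card])

/-- A polynomial factor is absorbed in an exponent tending to zero. -/
theorem PolyComparable.exists_exponent {q : ℕ} (hq : 1 < q) {k : ℕ}
    (H : PolyComparable S f fun n => (Real.sqrt q ^ n) ^ k) :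
    ∃ ε : ℕ → ℝ, Tendsto ε atTop (𝓝 0) ∧ ∀ n ∈ S, 1 ≤ n →
      f n = ((q : ℝ) ^ n) ^ ((k : ℝ) / 2 + ε n) := by
  classical
  obtain ⟨A, B, hB, H⟩ := H
  beta_reduce at H
  have hq1 : (1 : ℝ) < q := by exact_mod_cast hq
  have hq0 : (0 : ℝ) < q := by linarith
  have hlogq : 0 < Real.log q := Real.log_pos hq1
  refine ⟨fun n => if n ∈ S then Real.log (f n / (Real.sqrt q ^ n) ^ k) / (n * Real.log q) else 0,
    ?_, ?_⟩
  · have hlim : Tendsto (fun n : ℕ => (Real.log B / Real.log q) * (n : ℝ)⁻¹ +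
        (A / Real.log q) * (Real.log n / n)) atTop (𝓝 0) := by
      have h1 : Tendsto (fun n : ℕ => (n : ℝ)⁻¹) atTop (𝓝 0) := tendsto_inv_atTop_nhds_zero_nat
      have h2 : Tendsto (fun n : ℕ => Real.log n / n) atTop (𝓝 0) :=
        (Real.isLittleO_log_id_atTop.tendsto_div_nhds_zero).comp tendsto_natCast_atTop_atTop
      simpa using (h1.const_mul (Real.log B / Real.log q)).add (h2.const_mul (A / Real.log q))
    refine squeeze_zero_norm' ?_ hlim
    filter_upwards [eventually_ge_atTop 1] with n hn1
    have hn' : (1 : ℝ) ≤ n := by exact_mod_cast hn1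
    have hlogn : 0 ≤ Real.log n := Real.log_nonneg hn'
    have hlogB : 0 ≤ Real.log B := Real.log_nonneg hB
    split_ifs with hn
    · obtain ⟨a1, a2, a3, a4⟩ := H n hn hn1
      have hlogBA : Real.log (B * (n : ℝ) ^ A) = Real.log B + A * Real.log n := by
        rw [Real.log_mul (by positivity) (by positivity), Real.log_pow]
      have hden : 0 < n * Real.log q := by positivity
      rw [Real.norm_eq_abs, abs_div, abs_of_pos hden, div_le_iff₀ hden]
      have hr : (Real.log B / Real.log q * (n : ℝ)⁻¹ + A / Real.log q * (Real.log n / n)) *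
          (n * Real.log q) = Real.log B + A * Real.log n := by
        field_simp
      rw [hr, ← hlogBA, abs_le]
      constructor
      · rw [neg_le, ← Real.log_inv, inv_div]
        exact Real.log_le_log (div_pos a2 a1) ((div_le_iff₀ a1).2 a4)
      · exact Real.log_le_log (div_pos a1 a2) ((div_le_iff₀ a2).2 a3)
    · rw [norm_zero]
      positivity
  · intro n hn hn1
    obtain ⟨a1, a2, -, -⟩ := H n hn hn1
    have hn' : (0 : ℝ) < n := by exact_mod_cast hn1
    have hqn : (0 : ℝ) < (q : ℝ) ^ n := by positivity
    have hhalf : ((q : ℝ) ^ n) ^ ((k : ℝ) / 2) = (Real.sqrt q ^ n) ^ k := by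
      rw [Real.sqrt_eq_rpow, ← Real.rpow_natCast, ← Real.rpow_natCast, ← Real.rpow_natCast,
        ← Real.rpow_mul hq0.le, ← Real.rpow_mul hq0.le, ← Real.rpow_mul hq0.le]
      congr 1
      ring
    beta_reduce
    rw [if_pos hn, Real.rpow_add hqn, hhalf, Real.rpow_def_of_pos hqn, Real.log_pow,
      mul_div_cancel₀ _ (by positivity), Real.exp_log (div_pos a1 a2), mul_div_cancel₀ _ a2.ne']

end PolyComparable

/-! ### Size of the indices -/

section Estimates

open NumberField ComplexConjugate

variable {K : Type*} [Field K] [NumberField K] {q : ℕ} {α : K}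

/-- The integers `n` for which the `n`-th powers of distinct conjugates of `α` are at relative
distance at least `1 / n`. -/
def spreadSet (α : K) : Set ℕ :=
  {n | ∀ p : {p : (K →+* ℂ) × (K →+* ℂ) // p.1 ≠ p.2},
    (n : ℝ)⁻¹ ≤ ‖(p.1.1 α / p.1.2 α) ^ n - 1‖}

omit [NumberField K] in
theorem IsWeilNumber.norm_pow (hα : IsWeilNumber q α) (φ : K →+* ℂ) (n : ℕ) :
    ‖φ (α ^ n)‖ = Real.sqrt q ^ n := by
  rw [map_pow, _root_.norm_pow, hα.2 φ]

theorem IsWeilNumber.hasNaturalDensity_spreadSet (hα : IsWeilNumber q α) (hq : 0 < q)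
    (htop : ∀ n : ℕ, 1 ≤ n → ℚ⟮α ^ n⟯ = ⊤) : HasNaturalDensity (spreadSet α) 1 := by
  have hT : Real.sqrt q ≠ 0 := (Real.sqrt_pos.2 (by exact_mod_cast hq)).ne'
  refine hasNaturalDensity_pow_far_from_one
    (fun p : {p : (K →+* ℂ) × (K →+* ℂ) // p.1 ≠ p.2} => p.1.1 α / p.1.2 α) ?_ ?_
  · intro p
    rw [norm_div, hα.2, hα.2, div_self hT]
  · intro p m hm h
    have h0 : p.1.2 α ≠ 0 := (map_ne_zero _).2 (hα.ne_zero hq)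
    rw [div_pow, div_eq_one_iff_eq (pow_ne_zero _ h0), ← map_pow, ← map_pow] at h
    exact p.2 (ext_of_adjoin_simple_eq_top (htop m hm) h)

theorem IsWeilNumber.norm_sub_polyComparable (hα : IsWeilNumber q α) (hq : 0 < q)
    {φ ψ : K →+* ℂ} (h : φ ≠ ψ) :
    PolyComparable (spreadSet α) (fun n => ‖φ (α ^ n) - ψ (α ^ n)‖) fun n => Real.sqrt q ^ n := by
  have hT : 0 < Real.sqrt q := Real.sqrt_pos.2 (by exact_mod_cast hq)
  have hlow : ∀ n ∈ spreadSet α, 1 ≤ n →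
      Real.sqrt q ^ n * (n : ℝ)⁻¹ ≤ ‖φ (α ^ n) - ψ (α ^ n)‖ := by
    intro n hn _
    have h0 : ψ α ≠ 0 := (map_ne_zero _).2 (hα.ne_zero hq)
    have h1 : φ (α ^ n) - ψ (α ^ n) = ψ (α ^ n) * ((φ α / ψ α) ^ n - 1) := by
      rw [map_pow, map_pow, div_pow, mul_sub, mul_div_cancel₀ _ (pow_ne_zero _ h0), mul_one]
    rw [h1, norm_mul, hα.norm_pow]
    exact mul_le_mul_of_nonneg_left (hn ⟨(φ, ψ), h⟩) (by positivity)
  refine PolyComparable.of_le (A := 0) (A' := 1) (B := 2) (B' := 1) ?_ (fun n _ _ => by positivity)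
    ?_ ?_
  · intro n hn h1
    have hn' : (0 : ℝ) < n := by exact_mod_cast h1
    exact lt_of_lt_of_le (by positivity) (hlow n hn h1)
  · intro n _ _
    refine (norm_sub_le _ _).trans ?_
    rw [hα.norm_pow, hα.norm_pow, pow_zero]
    linarith
  · intro n hn h1
    have hn' : (0 : ℝ) < n := by exact_mod_cast h1
    calc Real.sqrt q ^ n = n * (Real.sqrt q ^ n * (n : ℝ)⁻¹) := by field_simp
      _ ≤ n * ‖φ (α ^ n) - ψ (α ^ n)‖ := by gcongr; exact hlow n hn h1
      _ = _ := by ring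

theorem IsWeilNumber.norm_real_trace_sub_polyComparable (hα : IsWeilNumber q α) (hq : 0 < q)
    {φ ψ : K →+* ℂ} (h : φ ≠ ψ) (h' : φ ≠ ComplexEmbedding.conjugate ψ) :
    PolyComparable (spreadSet α)
      (fun n => ‖φ (α ^ n + ((q : K) / α) ^ n) - ψ (α ^ n + ((q : K) / α) ^ n)‖)
      fun n => Real.sqrt q ^ n := by
  have hT : 0 < Real.sqrt q := Real.sqrt_pos.2 (by exact_mod_cast hq)
  have h0 := hα.ne_zero hq
  refine PolyComparable.mul_cancel_right (h := fun n => Real.sqrt q ^ n) ?_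
    fun n _ _ => by positivity
  refine ((hα.norm_sub_polyComparable hq h).mul (hα.norm_sub_polyComparable hq h')).congr ?_
    fun _ _ _ => rfl
  -- with `x = φ (α ^ n)` and `y = ψ (α ^ n)` one has `x (Tr x - Tr y) = (x - y) (x - conj y)`
  intro n _ _
  have hprod : ∀ χ : K →+* ℂ, χ (α ^ n) * χ (((q : K) / α) ^ n) = (q : ℂ) ^ n := fun χ => by
    rw [← map_mul, ← mul_pow, mul_div_cancel₀ _ h0, map_pow, map_natCast]
  have hconj : ComplexEmbedding.conjugate ψ (α ^ n) = ψ (((q : K) / α) ^ n) := by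
    rw [ComplexEmbedding.conjugate_coe_eq, map_pow, map_pow, map_pow, hα.conj_apply hq]
  rw [hconj, ← hα.norm_pow φ n, ← norm_mul, ← norm_mul, map_add, map_add]
  congr 1
  linear_combination -hprod φ + hprod ψ

variable [IsCMField K]

theorem conj_algebraMap_real (φ : K →+* ℂ) (x : maximalRealSubfield K) :
    ComplexEmbedding.conjugate φ (algebraMap _ K x) = φ (algebraMap _ K x) := by
  rw [ComplexEmbedding.conjugate_coe_eq, ← IsCMField.complexEmbedding_complexConj]
  exact congrArg φ (IsCMField.complexConj_apply_eq_self K x)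

theorem IsWeilNumber.orderIndex_real_polyComparable (hα : IsWeilNumber q α) (hq : 0 < q)
    (htop : ∀ n : ℕ, 1 ≤ n → ℚ⟮α ^ n⟯ = ⊤) {d : ℕ}
    (hd : Module.finrank ℚ (maximalRealSubfield K) = d) {β : ℕ → 𝓞 (maximalRealSubfield K)}
    (hβ : ∀ n, algebraMap (maximalRealSubfield K) K (β n) = α ^ n + ((q : K) / α) ^ n) :
    PolyComparable (spreadSet α)
      (fun n => (orderIndex (Algebra.adjoin ℤ {(β n : maximalRealSubfield K)}) : ℝ))
      fun n => (Real.sqrt q ^ n) ^ (∑ i : Fin d, (Finset.Ioi i).card) := by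
  obtain ⟨e⟩ : Nonempty (Fin d ≃ (maximalRealSubfield K →ₐ[ℚ] ℂ)) :=
    ⟨(Fintype.equivFinOfCardEq ((AlgHom.card ℚ (maximalRealSubfield K) ℂ).trans hd)).symm⟩
  set s : ℝ := Real.sqrt |(discr (maximalRealSubfield K) : ℝ)|
  have hs : 0 < s := Real.sqrt_pos.2 (abs_pos.2 (Int.cast_ne_zero.2 (discr_ne_zero _)))
  have hmain : ∀ n, 1 ≤ n →
      s * (orderIndex (Algebra.adjoin ℤ {(β n : maximalRealSubfield K)}) : ℝ) =
        ∏ i, ∏ j ∈ Finset.Ioi i, ‖e j (β n) - e i (β n)‖ := by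
    intro n hn
    have h1 := orderIndex_adjoin_sq hd (β n).isIntegral_coe
      (hα.adjoin_real_trace_eq_top hq (htop n hn) (hβ n)) e
    simp only [Finset.prod_pow] at h1
    rw [← Real.sq_sqrt (abs_nonneg (discr (maximalRealSubfield K) : ℝ)), ← mul_pow] at h1
    have h2 := (pow_left_inj₀ (by positivity)
      (Finset.prod_nonneg fun i _ => Finset.prod_nonneg fun j _ => norm_nonneg _) two_ne_zero).1 h1
    rw [mul_comm]
    exact h2
  have hprod : PolyComparable (spreadSet α)
      (fun n => ∏ i, ∏ j ∈ Finset.Ioi i, ‖e j (β n) - e i (β n)‖)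
      fun n => ∏ i : Fin d, ∏ j ∈ Finset.Ioi i, Real.sqrt q ^ n := by
    refine PolyComparable.prod _ fun i _ => PolyComparable.prod _ fun j hj => ?_
    set φ := ComplexEmbedding.lift K (e j : maximalRealSubfield K →+* ℂ)
    set ψ := ComplexEmbedding.lift K (e i : maximalRealSubfield K →+* ℂ)
    have e₁ : ∀ x, φ (algebraMap _ K x) = e j x := fun x =>
      ComplexEmbedding.lift_algebraMap_apply K (e j : maximalRealSubfield K →+* ℂ) x
    have e₂ : ∀ x, ψ (algebraMap _ K x) = e i x := fun x =>
      ComplexEmbedding.lift_algebraMap_apply K (e i : maximalRealSubfield K →+* ℂ) x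
    have hji : e j ≠ e i := fun h => (Finset.mem_Ioi.1 hj).ne' (e.injective h)
    have h1 : φ ≠ ψ := fun h => hji (AlgHom.ext fun x => by rw [← e₁, ← e₂, h])
    have h2 : φ ≠ ComplexEmbedding.conjugate ψ := fun h =>
      hji (AlgHom.ext fun x => by rw [← e₁, ← e₂, h, conj_algebraMap_real])
    refine (hα.norm_real_trace_sub_polyComparable hq h1 h2).congr (fun n _ _ => ?_)
      fun _ _ _ => rfl
    rw [← hβ, e₁, e₂]
  have hpos : ∀ n ∈ spreadSet α, 1 ≤ n →
      (0 : ℝ) < orderIndex (Algebra.adjoin ℤ {(β n : maximalRealSubfield K)}) := fun n _ hn => by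
    have := orderIndex_adjoin_ne_zero (β n).isIntegral_coe
      (hα.adjoin_real_trace_eq_top hq (htop n hn) (hβ n))
    exact_mod_cast Nat.pos_of_ne_zero this
  refine (PolyComparable.const_mul hs hpos).symm.trans (hprod.congr (fun n _ hn => (hmain n hn).symm)
    fun n _ _ => ?_)
  simp only [Finset.prod_const, Finset.prod_pow_eq_pow_sum]

theorem IsWeilNumber.absNorm_polyComparable (hα : IsWeilNumber q α) (hq : 0 < q)
    (htop : ∀ n : ℕ, 1 ≤ n → ℚ⟮α ^ n⟯ = ⊤) {d : ℕ}
    (hd : Module.finrank ℚ (maximalRealSubfield K) = d) {a b : ℕ → 𝓞 (maximalRealSubfield K)}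
    (hab : ∀ n, α ^ n = algebraMap (maximalRealSubfield K) K (a n) +
      algebraMap (maximalRealSubfield K) K (b n) * α) :
    PolyComparable (spreadSet α) (fun n => (Ideal.absNorm (Ideal.span {b n}) : ℝ))
      fun n => (Real.sqrt q ^ n) ^ d := by
  let l : (maximalRealSubfield K →ₐ[ℚ] ℂ) → K →+* ℂ := fun ψ =>
    ComplexEmbedding.lift K (ψ : maximalRealSubfield K →+* ℂ)
  have hl : ∀ ψ x, l ψ (algebraMap _ K x) = ψ x := fun ψ x =>
    ComplexEmbedding.lift_algebraMap_apply K (ψ : maximalRealSubfield K →+* ℂ) x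
  have hne : ∀ φ : K →+* ℂ, φ ≠ ComplexEmbedding.conjugate φ := fun φ h =>
    IsTotallyComplex.complexEmbedding_not_isReal φ h.symm
  set c : ℝ := ∏ ψ : maximalRealSubfield K →ₐ[ℚ] ℂ,
    ‖l ψ α - ComplexEmbedding.conjugate (l ψ) α‖
  have hc : 0 < c := by
    refine Finset.prod_pos fun ψ _ => norm_pos_iff.2 (sub_ne_zero.2 fun h => hne (l ψ) ?_)
    have h1 := htop 1 le_rfl
    rw [pow_one] at h1
    exact ext_of_adjoin_simple_eq_top h1 h
  -- subtracting the complex conjugate of `α ^ n = a + b α` isolates `b`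
  have hmain : ∀ n, c * (Ideal.absNorm (Ideal.span {b n}) : ℝ) =
      ∏ ψ : maximalRealSubfield K →ₐ[ℚ] ℂ,
        ‖l ψ (α ^ n) - ComplexEmbedding.conjugate (l ψ) (α ^ n)‖ := by
    intro n
    rw [absNorm_span_singleton_eq_prod, ← Finset.prod_mul_distrib]
    refine Finset.prod_congr rfl fun ψ _ => ?_
    rw [hab, map_add, map_add, map_mul, map_mul, conj_algebraMap_real, conj_algebraMap_real,
      hl, hl, ← norm_mul]
    congr 1
    ring
  have hprod : PolyComparable (spreadSet α)
      (fun n => ∏ ψ : maximalRealSubfield K →ₐ[ℚ] ℂ,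
        ‖l ψ (α ^ n) - ComplexEmbedding.conjugate (l ψ) (α ^ n)‖)
      fun n => ∏ ψ : maximalRealSubfield K →ₐ[ℚ] ℂ, Real.sqrt q ^ n :=
    PolyComparable.prod _ fun ψ _ => hα.norm_sub_polyComparable hq (hne _)
  obtain ⟨A, B, hB, H⟩ := hprod
  have hpos : ∀ n ∈ spreadSet α, 1 ≤ n → (0 : ℝ) < Ideal.absNorm (Ideal.span {b n}) := by
    intro n hn h1
    have h2 := (H n hn h1).1
    beta_reduce at h2
    rw [← hmain n] at h2
    exact pos_of_mul_pos_right h2 hc.le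
  refine (PolyComparable.const_mul hc hpos).symm.trans
    (PolyComparable.congr ⟨A, B, hB, H⟩ (fun n _ _ => (hmain n).symm) fun n _ _ => ?_)
  rw [Finset.prod_const, Finset.card_univ, AlgHom.card, hd]

end Estimates

/-! ### The ratio of class numbers -/

section ClassNumbers

open NumberField

/-- For orders of exponentially growing index, class number times unit index is the index up to
a polynomial factor. -/
theorem card_classGroup_polyComparable {F : Type*} [Field F] [NumberField F] {S : Set ℕ}
    {R : ℕ → Subalgebra ℤ F} (hR : ∀ n, ∀ x ∈ R n, IsIntegral ℤ x) {T : ℝ} (hT : 1 < T) {k : ℕ}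
    (H : PolyComparable S (fun n => (orderIndex (R n) : ℝ)) fun n => (T ^ n) ^ k) :
    PolyComparable S (fun n => (Nat.card (ClassGroup (R n)) : ℝ) *
      ((unitsIn (R n) F).relIndex (unitsIn (𝓞 F) F) : ℝ)) fun n => (orderIndex (R n) : ℝ) := by
  have hpos : ∀ n ∈ S, 1 ≤ n → (0 : ℝ) < orderIndex (R n) := by
    obtain ⟨A, B, hB, H⟩ := H
    exact fun n hn h1 => (H n hn h1).1
  obtain ⟨A, B, hB, HL⟩ := H.card_primeFactors hT (Module.finrank ℚ F)
  have hb := fun n (hn : n ∈ S) (h1 : 1 ≤ n) => card_classGroup_order_bounds (R n) (hR n)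
    (fun h => (hpos n hn h1).ne' (by rw [h, Nat.cast_zero]))
  have hL : ∀ n ∈ S, 1 ≤ n →
      (((orderIndex (R n)).primeFactors.card : ℝ) + 1) ^ Module.finrank ℚ F ≤ B * (n : ℝ) ^ A :=
    fun n hn h1 => ((HL n hn h1).2.2.1).trans_eq (mul_one _)
  refine PolyComparable.of_le (A := A) (A' := A) (B := Nat.card (ClassGroup (𝓞 F)) * B) (B' := B)
    ?_ hpos ?_ ?_
  · intro n hn h1
    have h2 := (hpos n hn h1).trans_le (hb n hn h1).2
    exact pos_of_mul_pos_left h2 (by positivity)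
  · intro n hn h1
    calc _ ≤ (Nat.card (ClassGroup (𝓞 F)) : ℝ) * (orderIndex (R n) *
          (((orderIndex (R n)).primeFactors.card : ℝ) + 1) ^ Module.finrank ℚ F) := (hb n hn h1).1
      _ ≤ (Nat.card (ClassGroup (𝓞 F)) : ℝ) * (orderIndex (R n) * (B * (n : ℝ) ^ A)) := by
          gcongr
          exact hL n hn h1
      _ = _ := by ring
  · intro n hn h1
    calc (orderIndex (R n) : ℝ) ≤ _ := (hb n hn h1).2
      _ ≤ (Nat.card (ClassGroup (R n)) : ℝ) *
          ((unitsIn (R n) F).relIndex (unitsIn (𝓞 F) F) : ℝ) * (B * (n : ℝ) ^ A) := by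
          gcongr
          exact hL n hn h1
      _ = _ := by ring

theorem sum_card_Ioi_fin (g : ℕ) : 2 * ∑ i : Fin g, (Finset.Ioi i).card + g = g * g := by
  simp only [Fin.card_Ioi]
  rw [Fin.sum_univ_eq_sum_range (fun i => g - 1 - i), Finset.sum_range_reflect (fun i => i) g,
    mul_comm, Finset.sum_range_id_mul_two]
  cases g with
  | zero => rfl
  | succ g => rw [Nat.add_sub_cancel]; ring

variable {K : Type*} [Field K] [NumberField K] [IsCMField K] {q : ℕ} {α : K}

theorem IsWeilNumber.card_ratio_polyComparable (hα : IsWeilNumber q α) (hq : 1 < q)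
    (htop : ∀ n : ℕ, 1 ≤ n → ℚ⟮α ^ n⟯ = ⊤) {d : ℕ}
    (hd : Module.finrank ℚ (maximalRealSubfield K) = d) :
    PolyComparable (spreadSet α)
      (fun n => (Nat.card (ClassGroup (weilOrder q α n)) : ℝ) /
        (Nat.card (NarrowClassGroup (realWeilOrder q α n)) : ℝ))
      fun n => (Real.sqrt q ^ n) ^ (∑ i : Fin d, (Finset.Ioi i).card + d) := by
  have hq0 : 0 < q := by omega
  have hT : 1 < Real.sqrt q := by
    rw [Real.lt_sqrt zero_le_one, one_pow]
    exact_mod_cast hq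
  set S := spreadSet α
  set P := ∑ i : Fin d, (Finset.Ioi i).card
  set N : ℕ → ℝ := fun n => Real.sqrt q ^ n
  have hN : ∀ n, 0 < N n := fun n => by positivity
  choose β hβ using hα.exists_real_trace hq0
  choose a b hab using hα.exists_pow_eq hq0
  let F := maximalRealSubfield K
  let R : ℕ → Subalgebra ℤ F := fun n => Algebra.adjoin ℤ {(β n : F)}
  let R' : ℕ → Subalgebra ℤ K := fun n => weilOrder q α n
  have hR : ∀ n, ∀ x ∈ R n, IsIntegral ℤ x := fun n x hx =>
    adjoin_le_integralClosure (β n).isIntegral_coe hx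
  have hR' : ∀ n, ∀ x ∈ R' n, IsIntegral ℤ x := by
    intro n x hx
    have hle : weilOrder q α n ≤ integralClosure ℤ K := by
      refine Algebra.adjoin_le ?_
      rintro y (rfl | rfl)
      · exact hα.1.pow n
      · exact (hα.isIntegral_div hq0).pow n
    exact hle hx
  let αi : 𝓞 K := ⟨α, hα.1⟩
  have hmem := fun n => hα.mem_weilOrder_iff hq0 (hβ n)
  have hα1 : ∀ x : F, algebraMap F K x ≠ αi := fun x => by
    have h1 := algebraMap_ne_pow (htop 1 le_rfl) x
    rwa [pow_one] at h1
  -- the index of `weilOrder q α n` in terms of the index of the real order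
  have hidx : ∀ n, 1 ≤ n → orderIndex (R' n) =
      orderIndex (R n) ^ 2 * (Ideal.absNorm (Ideal.span {b n}) * (pairHom F αi).range.index) := by
    intro n hn
    rw [← index_range_pairHom hα1 (γ := αi ^ n) (a := a n) (b := b n)
      (RingOfIntegers.ext (hab n))]
    exact orderIndex_of_pair (hR n) (algebraMap_ne_pow (htop n hn)) (hmem n)
  have hc1 : (0 : ℝ) < (pairHom F αi).range.index := by
    have := index_range_pairHom_ne_zero (Algebra.IsQuadraticExtension.finrank_eq_two F K) hα1
    exact_mod_cast Nat.pos_of_ne_zero this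
  have hm := hα.orderIndex_real_polyComparable hq0 htop hd hβ
  have hNorm := hα.absNorm_polyComparable hq0 htop hd hab
  have hNpos : ∀ n ∈ S, 1 ≤ n → (0 : ℝ) < Ideal.absNorm (Ideal.span {b n}) := by
    obtain ⟨A, B, hB, H⟩ := hNorm
    exact fun n hn h1 => (H n hn h1).1
  have hm' : PolyComparable S (fun n => (orderIndex (R' n) : ℝ)) fun n => N n ^ (2 * P + d) := by
    refine ((hm.mul hm).mul ((PolyComparable.const_mul hc1 hNpos).trans hNorm)).congr ?_ ?_
    · intro n _ h1
      rw [hidx n h1]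
      push_cast
      ring
    · intro n _ _
      ring
  have hX' := card_classGroup_polyComparable hR' hT hm'
  have hX := card_classGroup_polyComparable hR hT hm
  set e' : ℕ → ℕ := fun n => (unitsIn (R' n) K).relIndex (unitsIn (𝓞 K) K)
  set e : ℕ → ℕ := fun n => (unitsIn (R n) F).relIndex (unitsIn (𝓞 F) F)
  have hpos' : ∀ n ∈ S, 1 ≤ n → 0 < Nat.card (ClassGroup (R' n)) ∧ 0 < e' n := by
    obtain ⟨A, B, hB, H⟩ := hX'
    intro n hn h1
    have h3 : (0 : ℝ) < (Nat.card (ClassGroup (R' n)) : ℝ) * (e' n : ℝ) := (H n hn h1).1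
    have h2 : 0 < Nat.card (ClassGroup (R' n)) * e' n := by exact_mod_cast h3
    exact ⟨Nat.pos_of_mul_pos_right h2, Nat.pos_of_mul_pos_left h2⟩
  have hpos : ∀ n ∈ S, 1 ≤ n → 0 < Nat.card (ClassGroup (R n)) ∧ 0 < e n := by
    obtain ⟨A, B, hB, H⟩ := hX
    intro n hn h1
    have h3 : (0 : ℝ) < (Nat.card (ClassGroup (R n)) : ℝ) * (e n : ℝ) := (H n hn h1).1
    have h2 : 0 < Nat.card (ClassGroup (R n)) * e n := by exact_mod_cast h3
    exact ⟨Nat.pos_of_mul_pos_right h2, Nat.pos_of_mul_pos_left h2⟩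
  -- an element of the real subfield lies in `R' n` exactly when it lies in `R n`
  have hinter : ∀ n, 1 ≤ n → ∀ x : F, algebraMap F K x ∈ R' n ↔ x ∈ R n := by
    intro n hn x
    constructor
    · intro hx
      obtain ⟨y, hy, z, hz, h⟩ := (hmem n _).1 hx
      have hz0 : z = 0 := by
        by_contra hz0
        refine algebraMap_ne_pow (htop n hn) ((x - y) / z) ?_
        rw [map_div₀, map_sub, h, add_sub_cancel_left, mul_div_cancel_right₀]
        exact (map_ne_zero _).2 hz0
      rw [hz0, map_zero, mul_zero, add_zero] at h
      rwa [(algebraMap F K).injective h]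
    · intro hx
      exact (hmem n _).2 ⟨x, hx, 0, zero_mem _, by rw [map_zero, mul_zero, add_zero]⟩
  set w : ℕ := ((unitsIn (𝓞 F) F).map (Units.map (algebraMap F K : F →* K))).relIndex
    (unitsIn (𝓞 K) K)
  have hunits : ∀ n ∈ S, 1 ≤ n → e n ≤ e' n ∧ e' n ≤ e n * w := fun n hn h1 =>
    relIndex_unitsIn_bounds (hR n) (hinter n h1) (hpos n hn h1).2.ne' (hpos' n hn h1).2.ne'
  have hnarrow : ∀ n,
      Nat.card (ClassGroup (R n)) ≤ Nat.card (NarrowClassGroup (realWeilOrder q α n)) ∧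
      Nat.card (NarrowClassGroup (realWeilOrder q α n)) ≤
        2 ^ Module.finrank ℚ K * Nat.card (ClassGroup (R n)) := by
    intro n
    rw [← card_classGroup_realWeilOrder (hβ n)]
    exact card_narrowClassGroup_bounds (realWeilOrder q α n).val.toRingHom Subtype.val_injective
  have hNarrow : PolyComparable S
      (fun n => (Nat.card (NarrowClassGroup (realWeilOrder q α n)) : ℝ))
      fun n => (Nat.card (ClassGroup (R n)) : ℝ) := by
    refine PolyComparable.of_le (A := 0) (A' := 0) (B := 2 ^ Module.finrank ℚ K) (B' := 1) ?_ ?_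
      ?_ ?_
    · exact fun n hn h1 => by exact_mod_cast (hpos n hn h1).1.trans_le (hnarrow n).1
    · exact fun n hn h1 => by exact_mod_cast (hpos n hn h1).1
    · exact fun n _ _ => by rw [pow_zero, mul_one]; exact_mod_cast (hnarrow n).2
    · exact fun n _ _ => by rw [pow_zero, mul_one, one_mul]; exact_mod_cast (hnarrow n).1
  have hUnits : PolyComparable S (fun n => (e' n : ℝ)) fun n => (e n : ℝ) := by
    refine PolyComparable.of_le (A := 0) (A' := 0) (B := w) (B' := 1) ?_ ?_ ?_ ?_
    · exact fun n hn h1 => by exact_mod_cast (hpos' n hn h1).2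
    · exact fun n hn h1 => by exact_mod_cast (hpos n hn h1).2
    · exact fun n hn h1 => by
        rw [pow_zero, mul_one, mul_comm]; exact_mod_cast (hunits n hn h1).2
    · exact fun n hn h1 => by
        rw [pow_zero, mul_one, one_mul]; exact_mod_cast (hunits n hn h1).1
  have hfinal := (hX'.trans hm').mul (((hNarrow.mul hUnits).trans hX).trans hm).inv
  refine hfinal.congr ?_ ?_
  · intro n hn h1
    have h2 : (e' n : ℝ) ≠ 0 := by exact_mod_cast (hpos' n hn h1).2.ne'
    rw [← div_eq_mul_inv, mul_div_mul_right _ _ h2]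
  · intro n _ _
    have h2 : N n ^ (2 * P + d) = N n ^ (P + d) * N n ^ P := by ring
    show N n ^ (2 * P + d) * (N n ^ P)⁻¹ = _
    rw [h2, mul_inv_cancel_right₀ (pow_pos (hN n) _).ne']

end ClassNumbers

theorem lemma3p6 {K : Type*} [Field K] [NumberField K] (q g : ℕ) (hq : IsPrimePow q)
    (α : K) (hα : IsWeilNumber q α) (hg : Module.finrank ℚ K = 2 * g)
    (hsimple : ∀ n : ℕ, 1 ≤ n → ℚ⟮α ^ n⟯ = ⊤) :
    ∃ S : Set ℕ, HasNaturalDensity S 1 ∧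
      ∃ ε : ℕ → ℝ, Tendsto ε atTop (𝓝 0) ∧
        ∀ n ∈ S, 1 ≤ n →
          (Nat.card (ClassGroup (weilOrder q α n)) : ℝ) /
              (Nat.card (NarrowClassGroup (realWeilOrder q α n)) : ℝ) =
            ((q : ℝ) ^ n) ^ ((g : ℝ) * ((g : ℝ) + 1) / 4 + ε n) := by
  have hq1 : 1 < q := hq.one_lt
  have hq0 : 0 < q := by omega
  have h1 := hsimple 1 le_rfl
  rw [pow_one] at h1
  have hCM := hα.isCMField hq0 hg h1 (hsimple 2 one_le_two)
  have hd : Module.finrank ℚ (NumberField.maximalRealSubfield K) = g := by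
    have h2 := Module.finrank_mul_finrank ℚ (NumberField.maximalRealSubfield K) K
    rw [Algebra.IsQuadraticExtension.finrank_eq_two (NumberField.maximalRealSubfield K) K, hg] at h2
    omega
  obtain ⟨ε, hε, h⟩ := (hα.card_ratio_polyComparable hq1 hsimple hd).exists_exponent hq1
  refine ⟨spreadSet α, hα.hasNaturalDensity_spreadSet hq0 hsimple, ε, hε, fun n hn hn1 => ?_⟩
  rw [h n hn hn1]
  congr 2
  have h3 : 2 * ((∑ i : Fin g, (Finset.Ioi i).card : ℕ) : ℝ) + g = g * g := by
    exact_mod_cast sum_card_Ioi_fin g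
  push_cast at h3 ⊢
  linarith
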